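/- **Setting.** Let $p=p_1+p_2$. Observations are $y=(y_1,y_2)$ with $y_1\in\mathcal Y=\prod_{j\le p_1}\mathcal Y_j\subseteq\mathbb R^{p_1}$ and $y_2\in Q=\prod_{j\le p_2}\{k\in\mathbb N: k<q_j\}$, $q_j\in\mathbb N\cup\{\infty\}$; $\mu$ is the product of Lebesgue measure on $\mathcal Y$ and counting measure on $Q$, $\mathcal F$ is the set of probability densities with respect to $\mu$, and $\mathcal F^*$ the set of probability densities with respect to Lebesgue measure on $\mathbb R^p$. Let $h_{1,j}:\mathbb R\to\mathcal Y_j$ be monotone, one-to-one, onto and differentiable with derivative nonzero almost everywhere, $h_1=(h_{1,1},\dots,h_{1,p_1})$, and for each $j\le p_2$ let $\{A^{(j)}_k\}_{k<q_j}$ be a partition of $\mathbb R$ in which $A^{(j)}_k$ lies entirely to the left of $A^{(j)}_l$ whenever $k<l$. With $A_{y_2}=\prod_j A^{(j)}_{y_{2,j}}$ define $g:\mathcal F^*\to\mathcal F$ by $$g(f^*)(y_1,y_2)=\int_{A_{y_2}} f^*\big(h_1^{-1}(y_1),y_2^*\big)\,\big|\det J_{h_1^{-1}}(y_1)\big|\,dy_2^*.$$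 Let $\Pi^*$ be a prior (probability measure) on $\mathcal F^*$, let $\Pi=\Pi^*\circ g^{-1}$ be the induced prior on $\mathcal F$, and let $\Pi(\cdot\mid y_1,\dots,y_n)$ be its posterior, $\Pi(A\mid y_1,\dots,y_n)=\int_A\prod_i f(y_i)\,d\Pi(f)\big/\int\prod_i f(y_i)\,d\Pi(f)$, where $f(y)$ is evaluated through a version that is jointly measurable in $(f,y)$. **Theorem.** Let $d$ be either the $L_1$ distance $\int|f-f'|$ or the Hellinger distance $\big(\int(\sqrt f-\sqrt{f'})^2\big)^{1/2}$, and let $J(\delta,S)$ be the logarithm of the minimal number of $d$-balls of radius $\delta$ that cover $S\subseteq\mathcal F^*$. Let $f_0\in\mathcal F$, $f_0^*\in\mathcal F^*$ with $g(f_0^*)=f_0$, let $\epsilon_n\to0$ with $n\epsilon_n^2\to\infty$, let $C>0$ be a constant, let $\mathcal F_n^*\subset\mathcal F^*$, and put $$B_n^*=\Big\{f^*\in\mathcal F^*:\int f_0^*\log\frac{f_0^*}{f^*}\le\epsilon_n^2,\ \int f_0^*\Big(\log\frac{f_0^*}{f^*}\Big)^2\le\epsilon_n^2\Big\}.$$ Suppose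 that for all sufficiently large $n$ 1. $J(\epsilon_n,\mathcal F_n^*)<Cn\epsilon_n^2$; 2. $\Pi^*\big((\mathcal F_n^*)^{c}\big)\le\exp\{-n\epsilon_n^2(C+4)\}$; 3. $\Pi^*(B_n^*)\ge\exp\{-Cn\epsilon_n^2\}$. Then for every sufficiently large $M$, $$\Pi\big(\{f: d(f,f_0)\le M\epsilon_n\}^{c}\mid y_1,\dots,y_n\big)\to0$$ in $P_{f_0}$-probability, where $y_1,\dots,y_n$ are i.i.d. with density $f_0$. -/

import Mathlib

open MeasureTheory Filter Topology
open scoped ENNReal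

noncomputable section

/-! ### Probability densities with respect to a dominating measure -/

/-- A probability density with respect to `μ`: a measurable, nonnegative, real-valued function
whose integral is one. -/
structure Density {α : Type*} [MeasurableSpace α] (μ : Measure α) where
  toFun : α → ℝ
  measurable_toFun : Measurable toFun
  nonneg : ∀ x, 0 ≤ toFun x
  lintegral_eq_one : ∫⁻ x, ENNReal.ofReal (toFun x) ∂μ = 1

namespace Density

variable {α : Type*} [MeasurableSpace α] {μ : Measure α}

instance : CoeFun (Density μ) (fun _ => α → ℝ) := ⟨Density.toFun⟩

/-- The probability distribution `P_f` with density `f`. -/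
def toMeasure (f : Density μ) : Measure α := μ.withDensity (fun x => ENNReal.ofReal (f x))

instance (f : Density μ) : IsProbabilityMeasure f.toMeasure :=
  ⟨by rw [toMeasure, withDensity_apply _ MeasurableSet.univ, Measure.restrict_univ,
    f.lintegral_eq_one]⟩

/-- The σ-algebra on the set of densities: the one generated by the maps `f ↦ ∫_B f dμ`, `B`
measurable. (When `L¹(μ)` is separable it is the Borel σ-algebra of the `L¹` distance.) -/
instance : MeasurableSpace (Density μ) := MeasurableSpace.comap toMeasure inferInstance

theorem measurable_toMeasure : Measurable (toMeasure : Density μ → Measure α) :=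
  comap_measurable _

end Density

/-- The two distances between densities that are considered. -/
inductive DistanceKind
  | l1
  | hellinger

/-- The distance between two densities: `∫ |f - g| dμ`, respectively
`(∫ (√f - √g)² dμ)^{1/2}`. -/
def DistanceKind.dist {α : Type*} [MeasurableSpace α] {μ : Measure α} :
    DistanceKind → Density μ → Density μ → ℝ
  | .l1, f, g => ∫ x, |f x - g x| ∂μ
  | .hellinger, f, g => √(∫ x, (√(f x) - √(g x)) ^ 2 ∂μ)

/-- The smallest number of `d`-balls of radius `δ`, centred at densities, that cover `S`
(`⊤` if no finite number is enough). -/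
def coveringNumber {α : Type*} [MeasurableSpace α] {μ : Measure α} (d : DistanceKind) (δ : ℝ)
    (S : Set (Density μ)) : ℕ∞ :=
  ⨅ (T : Finset (Density μ)) (_ : ∀ f ∈ S, ∃ c ∈ T, d.dist f c < δ), (T.card : ℕ∞)

/-- The metric entropy `J(δ, S)`: the logarithm of the covering number. -/
def metricEntropy {α : Type*} [MeasurableSpace α] {μ : Measure α} (d : DistanceKind) (δ : ℝ)
    (S : Set (Density μ)) : EReal :=
  ENNReal.log ((coveringNumber d δ S : ℕ∞) : ℝ≥0∞)

/-- The densities `f` with `∫ f₀ log (f₀ / f) dμ ≤ ε²` and `∫ f₀ (log (f₀ / f))² dμ ≤ ε²`.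
The first three conditions express that the two integrals, in which `log (c / 0) = ∞` for `c > 0`
and `0 · log (0 / c) = 0`, are well defined and finite. -/
def klNeighborhood {α : Type*} [MeasurableSpace α] {μ : Measure α} (f₀ : Density μ) (ε : ℝ) :
    Set (Density μ) :=
  {f | (∀ᵐ x ∂μ, f x = 0 → f₀ x = 0) ∧
    Integrable (fun x => f₀ x * Real.log (f₀ x / f x)) μ ∧
    Integrable (fun x => f₀ x * Real.log (f₀ x / f x) ^ 2) μ ∧
    ∫ x, f₀ x * Real.log (f₀ x / f x) ∂μ ≤ ε ^ 2 ∧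
    ∫ x, f₀ x * Real.log (f₀ x / f x) ^ 2 ∂μ ≤ ε ^ 2}

/-! ### Posterior distribution -/

/-- `L` is a jointly measurable version of the likelihood `(f, y) ↦ f y`. -/
structure IsLikelihood {α : Type*} [MeasurableSpace α] {μ : Measure α}
    (L : Density μ → α → ℝ≥0∞) : Prop where
  measurable : Measurable (Function.uncurry L)
  ae_eq : ∀ f : Density μ, ∀ᵐ y ∂μ, L f y = ENNReal.ofReal (f y)

/-- A likelihood exists on every space with a countably generated σ-algebra and a σ-finite
dominating measure, hence in particular on the mixed scale sample space below. -/
theorem exists_isLikelihood {α : Type*} [MeasurableSpace α]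
    [MeasurableSpace.CountablyGenerated α] (μ : Measure α) [SigmaFinite μ] :
    ∃ L : Density μ → α → ℝ≥0∞, IsLikelihood L := by
  obtain ⟨ν, hν, hμν, hνμ⟩ := exists_isFiniteMeasure_absolutelyContinuous μ
  let κ : ProbabilityTheory.Kernel (Density μ) α := ⟨Density.toMeasure, Density.measurable_toMeasure⟩
  have hκ : ProbabilityTheory.IsMarkovKernel κ := ⟨fun f => by
    change IsProbabilityMeasure f.toMeasure; infer_instance⟩
  let η : ProbabilityTheory.Kernel (Density μ) α := ProbabilityTheory.Kernel.const _ ν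
  refine ⟨fun f y => κ.rnDeriv η f y * ν.rnDeriv μ y, ?_, ?_⟩
  · exact (ProbabilityTheory.Kernel.measurable_rnDeriv κ η).mul
      ((Measure.measurable_rnDeriv ν μ).comp measurable_snd)
  · intro f
    have h1 : κ.rnDeriv η f =ᵐ[ν] f.toMeasure.rnDeriv ν :=
      ProbabilityTheory.Kernel.rnDeriv_eq_rnDeriv_measure (κ := κ) (η := η) (a := f)
    have h2 := hμν.ae_le h1
    have h3 : f.toMeasure ≪ ν := (withDensity_absolutelyContinuous _ _).trans hμν
    have h4 := Measure.rnDeriv_mul_rnDeriv (κ := μ) h3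
    have h5 : f.toMeasure.rnDeriv μ =ᵐ[μ] fun x => ENNReal.ofReal (f x) :=
      Measure.rnDeriv_withDensity μ f.measurable_toFun.ennreal_ofReal
    filter_upwards [h2, h4, h5] with y a b c
    rw [a, ← c, ← b]
    rfl

/-- The posterior distribution for the prior `P` given the sample `y = (y₁, …, yₙ)`, by Bayes' formula
`A ↦ ∫_A ∏ f(yᵢ) dP(f) / ∫ ∏ f(yᵢ) dP(f)`. -/
def posteriorMeasure {α : Type*} [MeasurableSpace α] {μ : Measure α} (P : Measure (Density μ))
    (L : Density μ → α → ℝ≥0∞) {n : ℕ} (y : Fin n → α) : Measure (Density μ) :=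
  (∫⁻ f, ∏ i, L f (y i) ∂P)⁻¹ • P.withDensity (fun f => ∏ i, L f (y i))

/-! ### Mixed scale data and rounding -/

/-- The levels `0, 1, …, q - 1` of a discrete variable; all of `ℕ` if `q = ∞`. -/
abbrev Level (q : ℕ∞) : Type := {k : ℕ // (k : ℕ∞) < q}

/-- The latent space `ℝ^p`, `p = p₁ + p₂`, written as `ℝ^{p₁} × ℝ^{p₂}`. -/
abbrev Latent (p₁ p₂ : ℕ) : Type := (Fin p₁ → ℝ) × (Fin p₂ → ℝ)

/-- Mixed scale observations: `p₁` continuous and `p₂` discrete coordinates. -/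
abbrev Mixed (p₁ : ℕ) {p₂ : ℕ} (q : Fin p₂ → ℕ∞) : Type := (Fin p₁ → ℝ) × (∀ j, Level (q j))

/-- The data of the rounding map `h`: monotone one-to-one differentiable maps for the continuous
coordinates and ordered partitions of `ℝ` for the discrete ones. -/
structure Rounding (p₁ : ℕ) {p₂ : ℕ} (q : Fin p₂ → ℕ∞) where
  h₁ : Fin p₁ → ℝ → ℝ
  monotone_or_antitone : ∀ j, Monotone (h₁ j) ∨ Antitone (h₁ j)
  injective : ∀ j, Function.Injective (h₁ j)
  differentiable : ∀ j, Differentiable ℝ (h₁ j)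
  /-- The inverse of `h₁ j` is differentiable up to a null set, so that its Jacobian makes sense. -/
  deriv_ne_zero : ∀ j, ∀ᵐ x : ℝ, deriv (h₁ j) x ≠ 0
  A : ∀ j, Level (q j) → Set ℝ
  partition : ∀ j x, ∃! k, x ∈ A j k
  ordered : ∀ j k l, k < l → ∀ x ∈ A j k, ∀ z ∈ A j l, x < z

namespace Rounding

variable {p₁ p₂ : ℕ} {q : Fin p₂ → ℕ∞} (R : Rounding p₁ q)

/-- The range `𝒴` of the continuous observations. -/
def Y : Set (Fin p₁ → ℝ) := Set.univ.pi fun j => Set.range (R.h₁ j)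

/-- The dominating measure: Lebesgue measure on `𝒴` times counting measure. -/
def μ : Measure (Mixed p₁ q) := ((volume : Measure (Fin p₁ → ℝ)).restrict R.Y).prod Measure.count

instance : SigmaFinite R.μ := by unfold μ; infer_instance

/-- The inverse of the coordinatewise map `h₁` (used on `𝒴` only). -/
def h₁Inv (y : Fin p₁ → ℝ) : Fin p₁ → ℝ := fun j => Function.invFun (R.h₁ j) (y j)

/-- The Jacobian determinant of the coordinatewise inverse of `h₁`. -/
def jacobianInv (y : Fin p₁ → ℝ) : ℝ := ∏ j, deriv (Function.invFun (R.h₁ j)) (y j)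

/-- The set of latent values that are rounded to `y₂`. -/
def cell (y₂ : ∀ j, Level (q j)) : Set (Fin p₂ → ℝ) := {z | ∀ j, z j ∈ R.A j (y₂ j)}

/-- The function `y ↦ ∫_{A_{y₂}} f*(h₁⁻¹(y₁), z) |J_{h₁⁻¹}(y₁)| dz`. -/
def gFun (f : Latent p₁ p₂ → ℝ) (y : Mixed p₁ q) : ℝ :=
  ∫ z in R.cell y.2, f (R.h₁Inv y.1, z) * |R.jacobianInv y.1|

theorem measurableSet_A (j : Fin p₂) (k : Level (q j)) : MeasurableSet (R.A j k) := by
  apply Set.OrdConnected.measurableSet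
  refine ⟨fun x hx z hz w hw => ?_⟩
  obtain ⟨l, hl, -⟩ := R.partition j w
  rcases lt_trichotomy l k with h | h | h
  · exact absurd (R.ordered j l k h w hl x hx) (not_lt.mpr hw.1)
  · exact h ▸ hl
  · exact absurd (R.ordered j k l h z hz w hl) (not_lt.mpr hw.2)

theorem measurableSet_cell (y₂ : ∀ j, Level (q j)) : MeasurableSet (R.cell y₂) := by
  have : R.cell y₂ = Set.univ.pi fun j => R.A j (y₂ j) := by
    ext z; simp [cell, Set.mem_pi]
  rw [this]
  exact MeasurableSet.univ_pi fun j => R.measurableSet_A j _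

theorem existsUnique_mem_cell (z : Fin p₂ → ℝ) : ∃! y₂, z ∈ R.cell y₂ := by
  choose k hk hu using fun j => R.partition j (z j)
  exact ⟨k, hk, fun l hl => funext fun j => hu j _ (hl j)⟩

/-- The thresholding map `h₂`: the vector of levels of the cell that contains `z`. -/
def h₂ (z : Fin p₂ → ℝ) : ∀ j, Level (q j) := (R.existsUnique_mem_cell z).choose

/-- The rounding map `y = h(y*)`. -/
def h (x : Latent p₁ p₂) : Mixed p₁ q := (fun j => R.h₁ j (x.1 j), R.h₂ x.2)

theorem mem_cell_iff (z : Fin p₂ → ℝ) (y₂ : ∀ j, Level (q j)) :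
    z ∈ R.cell y₂ ↔ R.h₂ z = y₂ :=
  ⟨fun hz => ((R.existsUnique_mem_cell z).choose_spec.2 _ hz).symm,
    fun hz => hz ▸ (R.existsUnique_mem_cell z).choose_spec.1⟩

theorem measurable_h₂ : Measurable R.h₂ := by
  refine measurable_to_countable' fun y₂ => ?_
  have : R.h₂ ⁻¹' {y₂} = R.cell y₂ := by
    ext z; simp [mem_cell_iff]
  rw [this]
  exact R.measurableSet_cell _

theorem measurable_h : Measurable R.h :=
  Measurable.prodMk
    (measurable_pi_lambda _ fun j => (R.differentiable j).continuous.measurable.comp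
      ((measurable_pi_apply j).comp measurable_fst))
    (R.measurable_h₂.comp measurable_snd)

theorem isOpenEmbedding_h₁ (j : Fin p₁) : IsOpenEmbedding (R.h₁ j) := by
  have hc := (R.differentiable j).continuous
  refine IsOpenEmbedding.of_continuous_injective_isOpenMap hc (R.injective j) ?_
  have hloc : ∀ a b : ℝ, IsOpen (R.h₁ j '' Set.Ioo a b) := by
    intro a b
    rcases hc.strictMono_of_inj (R.injective j) with hm | hm
    · by_cases hab : a < b
      · have : R.h₁ j '' Set.Ioo a b = Set.Ioo (R.h₁ j a) (R.h₁ j b) := by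
          apply Set.Subset.antisymm
          · rintro _ ⟨x, hx, rfl⟩
            exact ⟨hm hx.1, hm hx.2⟩
          · exact intermediate_value_Ioo hab.le hc.continuousOn
        rw [this]; exact isOpen_Ioo
      · simp [Set.Ioo_eq_empty hab]
    · by_cases hab : a < b
      · have : R.h₁ j '' Set.Ioo a b = Set.Ioo (R.h₁ j b) (R.h₁ j a) := by
          apply Set.Subset.antisymm
          · rintro _ ⟨x, hx, rfl⟩
            exact ⟨hm hx.2, hm hx.1⟩
          · exact intermediate_value_Ioo' hab.le hc.continuousOn
        rw [this]; exact isOpen_Ioo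
      · simp [Set.Ioo_eq_empty hab]
  intro U hU
  rw [isOpen_iff_mem_nhds]
  rintro _ ⟨x, hx, rfl⟩
  obtain ⟨a, b, hxab, hab⟩ := mem_nhds_iff_exists_Ioo_subset.1 (hU.mem_nhds hx)
  exact Filter.mem_of_superset ((hloc a b).mem_nhds ⟨x, hxab, rfl⟩) (Set.image_mono hab)

theorem invFun_h₁ (j : Fin p₁) (x : ℝ) : Function.invFun (R.h₁ j) (R.h₁ j x) = x :=
  Function.leftInverse_invFun (R.injective j) x

theorem continuousAt_invFun (j : Fin p₁) (x : ℝ) :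
    ContinuousAt (Function.invFun (R.h₁ j)) (R.h₁ j x) := by
  rw [(R.isOpenEmbedding_h₁ j).continuousAt_iff.symm]
  have : Function.invFun (R.h₁ j) ∘ R.h₁ j = id := funext fun x => R.invFun_h₁ j x
  rw [this]
  exact continuousAt_id

theorem measurable_invFun (j : Fin p₁) : Measurable (Function.invFun (R.h₁ j)) := by
  classical
  have he := (R.isOpenEmbedding_h₁ j).measurableEmbedding
  have : Function.invFun (R.h₁ j) =
      Function.extend (R.h₁ j) id (fun _ => Classical.arbitrary ℝ) := by
    funext y
    by_cases hy : ∃ x, R.h₁ j x = y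
    · obtain ⟨x, rfl⟩ := hy
      rw [R.invFun_h₁, (R.injective j).extend_apply]; rfl
    · rw [Function.extend_apply' _ _ _ hy, Function.invFun_neg hy]
  rw [this]
  exact he.measurable_extend measurable_id measurable_const

theorem measurable_h₁Inv : Measurable R.h₁Inv :=
  measurable_pi_lambda _ fun j => (R.measurable_invFun j).comp (measurable_pi_apply j)

theorem measurable_jacobianInv : Measurable R.jacobianInv :=
  Finset.measurable_prod _ fun j _ => (measurable_deriv _).comp (measurable_pi_apply j)

theorem lintegral_h₁Inv (φ : (Fin p₁ → ℝ) → ℝ≥0∞) :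
    ∫⁻ y in R.Y, φ (R.h₁Inv y) * ENNReal.ofReal |R.jacobianInv y| = ∫⁻ x, φ x := by
  let H : (Fin p₁ → ℝ) → (Fin p₁ → ℝ) := fun x j => R.h₁ j (x j)
  have hinv : ∀ x, R.h₁Inv (H x) = x := fun x => funext fun j => R.invFun_h₁ j (x j)
  have hY : R.Y = H '' Set.univ := by
    ext y
    simp only [Y, Set.mem_univ_pi, Set.mem_range, Set.image_univ]
    constructor
    · intro hy
      choose x hx using hy
      exact ⟨x, funext hx⟩
    · rintro ⟨x, rfl⟩ j
      exact ⟨x j, rfl⟩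
  let H' : (Fin p₁ → ℝ) → (Fin p₁ → ℝ) →L[ℝ] (Fin p₁ → ℝ) := fun x =>
    ContinuousLinearMap.pi fun j =>
      (ContinuousLinearMap.toSpanSingleton ℝ (deriv (R.h₁ j) (x j))).comp
        (ContinuousLinearMap.proj j)
  have hdet : ∀ x, (H' x).det = ∏ j, deriv (R.h₁ j) (x j) := by
    intro x
    simp only [H']
    rw [ContinuousLinearMap.det_pi]
    simp
  have hH : ∀ x ∈ Set.univ, HasFDerivWithinAt H (H' x) Set.univ x := by
    intro x _
    refine HasFDerivAt.hasFDerivWithinAt ?_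
    rw [hasFDerivAt_pi]
    intro j
    exact (((R.differentiable j) (x j)).hasDerivAt.hasFDerivAt).comp x
      (ContinuousLinearMap.proj (R := ℝ) (φ := fun _ : Fin p₁ => ℝ) j).hasFDerivAt
  have hinj : Set.InjOn H Set.univ := fun x _ y _ hxy => by
    rw [← hinv x, hxy, hinv y]
  rw [hY, lintegral_image_eq_lintegral_abs_det_fderiv_mul volume MeasurableSet.univ hH hinj,
    Measure.restrict_univ]
  have hae : ∀ᵐ x : Fin p₁ → ℝ, ∀ j, deriv (R.h₁ j) (x j) ≠ 0 := by
    rw [ae_all_iff]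
    intro j
    exact (Measure.quasiMeasurePreserving_eval (fun _ : Fin p₁ => (volume : Measure ℝ)) j).ae
      (R.deriv_ne_zero j)
  refine lintegral_congr_ae ?_
  filter_upwards [hae] with x hx
  have hJ : R.jacobianInv (H x) = (∏ j, deriv (R.h₁ j) (x j))⁻¹ := by
    rw [jacobianInv, ← Finset.prod_inv_distrib]
    refine Finset.prod_congr rfl fun j _ => ?_
    have h1 := R.continuousAt_invFun j (x j)
    have h2 : HasDerivAt (R.h₁ j) (deriv (R.h₁ j) (x j))
        (Function.invFun (R.h₁ j) (R.h₁ j (x j))) := by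
      rw [R.invFun_h₁]
      exact ((R.differentiable j) (x j)).hasDerivAt
    refine (HasDerivAt.of_local_left_inverse h1 h2 (hx j) ?_).deriv
    filter_upwards [(R.isOpenEmbedding_h₁ j).isOpen_range.mem_nhds ⟨x j, rfl⟩] with y hy
    exact Function.invFun_eq hy
  have hne : ∏ j, deriv (R.h₁ j) (x j) ≠ 0 := Finset.prod_ne_zero_iff.2 fun j _ => hx j
  rw [hinv, hJ, hdet, mul_left_comm, ← ENNReal.ofReal_mul (abs_nonneg _), ← abs_mul,
    mul_inv_cancel₀ hne]
  simp

/-- The `[0, ∞]`-valued form of `gFun`. -/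
def gENN (f : Latent p₁ p₂ → ℝ) (y : Mixed p₁ q) : ℝ≥0∞ :=
  ∫⁻ z in R.cell y.2, ENNReal.ofReal (f (R.h₁Inv y.1, z) * |R.jacobianInv y.1|)

theorem measurable_gENN {f : Latent p₁ p₂ → ℝ} (hf : Measurable f) : Measurable (R.gENN f) := by
  refine measurable_from_prod_countable_left fun y₂ => ?_
  unfold gENN
  refine Measurable.lintegral_prod_right (ν := volume.restrict (R.cell y₂)) (f := fun y₁ z =>
    ENNReal.ofReal (f (R.h₁Inv y₁, z) * |R.jacobianInv y₁|)) ?_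
  refine Measurable.ennreal_ofReal (Measurable.mul ?_ ?_)
  · exact hf.comp ((R.measurable_h₁Inv.comp measurable_fst).prodMk measurable_snd)
  · exact (R.measurable_jacobianInv.comp measurable_fst).abs

theorem gFun_eq {f : Latent p₁ p₂ → ℝ} (hf : Measurable f) (h0 : ∀ x, 0 ≤ f x)
    (y : Mixed p₁ q) : R.gFun f y = (R.gENN f y).toReal := by
  refine integral_eq_lintegral_of_nonneg_ae
    (ae_of_all _ fun z => mul_nonneg (h0 _) (abs_nonneg _)) ?_
  exact ((hf.comp measurable_prodMk_left).mul_const _).aestronglyMeasurable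

theorem lintegral_gENN {f : Latent p₁ p₂ → ℝ} (hf : Measurable f) (h0 : ∀ x, 0 ≤ f x)
    {φ : Mixed p₁ q → ℝ≥0∞} (hφ : Measurable φ) :
    ∫⁻ y, φ y * R.gENN f y ∂(R.μ) = ∫⁻ x, φ (R.h x) * ENNReal.ofReal (f x) := by
  rw [μ, lintegral_prod (fun y => φ y * R.gENN f y) (hφ.mul (R.measurable_gENN hf)).aemeasurable]
  have hcell : (⋃ y₂, R.cell y₂) = Set.univ := by
    ext z
    simp only [Set.mem_iUnion, Set.mem_univ, iff_true]
    exact (R.existsUnique_mem_cell z).exists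
  have hdisj : Pairwise (Function.onFun Disjoint R.cell) := by
    intro y₂ y₃ hne
    rw [Function.onFun, Set.disjoint_left]
    intro z hz hz'
    rw [mem_cell_iff] at hz hz'
    exact hne (hz.symm.trans hz')
  have key : ∀ y₁ ∈ R.Y, ∫⁻ y₂, φ (y₁, y₂) * R.gENN f (y₁, y₂) ∂Measure.count =
      (fun x₁ => ∫⁻ z, φ (R.h (x₁, z)) * ENNReal.ofReal (f (x₁, z))) (R.h₁Inv y₁) *
        ENNReal.ofReal |R.jacobianInv y₁| := by
    intro y₁ hy₁
    have hback : (fun j => R.h₁ j (R.h₁Inv y₁ j)) = y₁ :=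
      funext fun j => Function.invFun_eq (hy₁ j (Set.mem_univ j))
    have hm : Measurable fun z => φ (R.h (R.h₁Inv y₁, z)) * ENNReal.ofReal (f (R.h₁Inv y₁, z)) :=
      (hφ.comp (R.measurable_h.comp measurable_prodMk_left)).mul
        (hf.comp measurable_prodMk_left).ennreal_ofReal
    rw [lintegral_count, ← lintegral_mul_const _ hm]
    conv_rhs => rw [← Measure.restrict_univ (μ := (volume : Measure (Fin p₂ → ℝ))), ← hcell,
      lintegral_iUnion (fun y₂ => R.measurableSet_cell y₂) hdisj]
    refine tsum_congr fun y₂ => ?_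
    have hm2 : Measurable fun z =>
        ENNReal.ofReal (f (R.h₁Inv y₁, z) * |R.jacobianInv y₁|) :=
      ((hf.comp measurable_prodMk_left).mul_const _).ennreal_ofReal
    rw [gENN, ← lintegral_const_mul _ hm2]
    refine setLIntegral_congr_fun (R.measurableSet_cell y₂) fun z hz => ?_
    rw [mem_cell_iff] at hz
    simp only [h, hback, hz]
    rw [ENNReal.ofReal_mul (h0 _), mul_assoc]
  have hYm : MeasurableSet R.Y :=
    MeasurableSet.univ_pi fun j => (R.isOpenEmbedding_h₁ j).isOpen_range.measurableSet
  rw [setLIntegral_congr_fun hYm key, R.lintegral_h₁Inv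
    (fun x₁ => ∫⁻ z, φ (R.h (x₁, z)) * ENNReal.ofReal (f (x₁, z)))]
  rw [Measure.volume_eq_prod, lintegral_prod (fun x => φ (R.h x) * ENNReal.ofReal (f x))
    ((hφ.comp R.measurable_h).mul hf.ennreal_ofReal).aemeasurable]

theorem ofReal_gFun {f : Density (volume : Measure (Latent p₁ p₂))} :
    ∀ᵐ y ∂(R.μ), ENNReal.ofReal (R.gFun f y) = R.gENN f y := by
  have h1 := R.lintegral_gENN f.measurable_toFun f.nonneg (φ := fun _ => 1) measurable_const
  simp only [one_mul, f.lintegral_eq_one] at h1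
  have h2 := ae_lt_top (R.measurable_gENN f.measurable_toFun) (by rw [h1]; simp)
  filter_upwards [h2] with y hy
  rw [R.gFun_eq f.measurable_toFun f.nonneg, ENNReal.ofReal_toReal hy.ne]

/-- The map `g` from latent densities to mixed scale densities. -/
def g (f : Density (volume : Measure (Latent p₁ p₂))) : Density R.μ where
  toFun := R.gFun f
  measurable_toFun := by
    have : R.gFun f = fun y => (R.gENN f y).toReal :=
      funext fun y => R.gFun_eq f.measurable_toFun f.nonneg y
    rw [this]
    exact (R.measurable_gENN f.measurable_toFun).ennreal_toReal
  nonneg y := integral_nonneg fun z => mul_nonneg (f.nonneg _) (abs_nonneg _)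
  lintegral_eq_one := by
    have h1 := R.lintegral_gENN f.measurable_toFun f.nonneg (φ := fun _ => 1) measurable_const
    simp only [one_mul, f.lintegral_eq_one] at h1
    rw [lintegral_congr_ae R.ofReal_gFun, h1]

/-- If `y*` has density `f`, then `y = h(y*)` has density `g f`. -/
theorem toMeasure_g (f : Density (volume : Measure (Latent p₁ p₂))) :
    (R.g f).toMeasure = f.toMeasure.map R.h := by
  ext B hB
  rw [Measure.map_apply R.measurable_h hB, Density.toMeasure, Density.toMeasure,
    withDensity_apply _ hB, withDensity_apply _ (R.measurable_h hB),
    ← lintegral_indicator hB, ← lintegral_indicator (R.measurable_h hB)]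
  have h1 := R.lintegral_gENN f.measurable_toFun f.nonneg (φ := B.indicator fun _ => 1)
    (measurable_const.indicator hB)
  have e1 : ∫⁻ y, B.indicator (fun y => ENNReal.ofReal (R.g f y)) y ∂(R.μ) =
      ∫⁻ y, B.indicator (fun _ => 1) y * R.gENN f y ∂(R.μ) := by
    refine lintegral_congr_ae ?_
    filter_upwards [R.ofReal_gFun (f := f)] with y hy
    by_cases hyB : y ∈ B
    · simp only [Set.indicator_of_mem hyB, one_mul]
      exact hy
    · simp [hyB]
  rw [e1, h1]
  refine lintegral_congr fun x => ?_
  by_cases hx : R.h x ∈ B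
  · simp [hx]
  · simp [hx]

theorem measurable_g : Measurable R.g := by
  have h1 : Measurable (Density.toMeasure ∘ R.g) := by
    have : Density.toMeasure ∘ R.g = fun f => f.toMeasure.map R.h :=
      funext fun f => R.toMeasure_g f
    rw [this]
    exact (Measure.measurable_map _ R.measurable_h).comp Density.measurable_toMeasure
  exact measurable_comap_iff.2 h1

end Rounding

end

noncomputable section

/-! ### Products of densities -/

/-! The map `g` sends the density of `y*` to the density of `h(y*)`, so it is push-forward along the
rounding map. Both distances can only shrink under push-forward (`dist_le_of_map`). Hence a cover of
the latent sieve by balls of radius ε is carried to a cover of its image by balls of the same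
radius, and the induced prior misses that image with no more mass than the latent prior misses the
sieve.

The Kullback–Leibler condition is not transferred to the rounded densities. The second moment of the
log ratio has no evident monotonicity under `g`, so the lower bound for the marginal likelihood
(`pi_marginal_lt_le`) treats an event of the rounded sample as an event of the latent sample,
changes measure there by Chebyshev's inequality, and averages over the prior. Apart from an event of
probability at most 2/(nε²), the marginal likelihood is at least a constant times exp(-(C+2)nε²)
times the true likelihood.

The rest is the testing argument. For each centre at distance at least r from `f₀`, a product
statistic separates `f₀` from the ball of radius r/16 around that centre, with both errors at most
exp(-nr²/16) (`exists_test_statistic`). A union bound over at most exp(Cnε²) centres controls false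
rejection; off the rejection region, Fubini and Markov bound the numerator of Bayes' formula
(`pi_posteriorMeasure_gt_le`). With r = (M-1)ε and M large, all terms vanish as nε² grows. -/

theorem lintegral_pi_prod_eq_prod {α : Type*} [MeasurableSpace α] (μ : Measure α) [SigmaFinite μ]
    {n : ℕ} (f : Fin n → α → ℝ≥0∞) (hf : ∀ i, Measurable (f i)) :
    ∫⁻ x, ∏ i, f i (x i) ∂(Measure.pi fun _ : Fin n => μ) = ∏ i, ∫⁻ x, f i x ∂μ := by
  induction n with
  | zero => simp
  | succ n ih =>
    have hm : Measurable fun x : Fin n → α => ∏ i : Fin n, f i.succ (x i) :=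
      Finset.measurable_prod _ fun i _ => (hf i.succ).comp (measurable_pi_apply i)
    rw [← (measurePreserving_piFinSuccAbove (fun _ : Fin (n + 1) => μ) 0).symm.lintegral_comp_emb
      (MeasurableEquiv.measurableEmbedding _)]
    simp_rw [MeasurableEquiv.piFinSuccAbove_symm_apply, Fin.insertNthEquiv,
      Fin.prod_univ_succ, Fin.insertNth_zero, Equiv.coe_fn_mk, Fin.cons_succ, Fin.cons_zero]
    rw [← ih (fun i => f i.succ) fun i => hf i.succ]
    exact lintegral_prod_mul (hf 0).aemeasurable hm.aemeasurable

theorem pi_withDensity_eq {α : Type*} [MeasurableSpace α] (μ : Measure α) [SigmaFinite μ]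
    (n : ℕ) {f : α → ℝ≥0∞} (hf : Measurable f) [SigmaFinite (μ.withDensity f)] :
    Measure.pi (fun _ : Fin n => μ.withDensity f) =
      (Measure.pi fun _ : Fin n => μ).withDensity fun x => ∏ i, f (x i) := by
  refine Measure.pi_eq fun s hs => ?_
  rw [withDensity_apply _ (MeasurableSet.univ_pi hs), ← lintegral_indicator (MeasurableSet.univ_pi hs)]
  have : ∀ x : Fin n → α, (Set.univ.pi s).indicator (fun x => ∏ i, f (x i)) x =
      ∏ i, (s i).indicator f (x i) := by
    intro x
    by_cases hx : x ∈ Set.univ.pi s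
    · rw [Set.indicator_of_mem hx]
      exact Finset.prod_congr rfl fun i _ => (Set.indicator_of_mem (hx i trivial) f).symm
    · rw [Set.indicator_of_notMem hx]
      simp only [Set.mem_pi, Set.mem_univ, true_imp_iff, not_forall] at hx
      obtain ⟨i, hi⟩ := hx
      exact (Finset.prod_eq_zero (Finset.mem_univ i) (Set.indicator_of_notMem hi f)).symm
  simp_rw [this]
  rw [lintegral_pi_prod_eq_prod μ (fun i => (s i).indicator f) fun i => hf.indicator (hs i)]
  exact Finset.prod_congr rfl fun i _ => by
    rw [lintegral_indicator (hs i), withDensity_apply _ (hs i)]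

/-- Markov's inequality for a product statistic of an i.i.d. sample. -/
theorem pi_one_le_prod_le {α : Type*} [MeasurableSpace α] (P : Measure α) [IsProbabilityMeasure P]
    (n : ℕ) {ψ : α → ℝ≥0∞} (hψ : Measurable ψ) :
    Measure.pi (fun _ : Fin n => P) {x | 1 ≤ ∏ i, ψ (x i)} ≤ (∫⁻ x, ψ x ∂P) ^ n := by
  have hm : Measurable fun x : Fin n → α => ∏ i, ψ (x i) :=
    Finset.measurable_prod _ fun i _ => hψ.comp (measurable_pi_apply i)
  have h := mul_meas_ge_le_lintegral (μ := Measure.pi fun _ : Fin n => P) hm 1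
  rw [one_mul, lintegral_pi_prod_eq_prod P (fun _ => ψ) fun _ => hψ] at h
  simpa using h

namespace Density

variable {α : Type*} [MeasurableSpace α] {μ : Measure α}

theorem pi_toMeasure [SigmaFinite μ] (f : Density μ) (n : ℕ) :
    Measure.pi (fun _ : Fin n => f.toMeasure) =
      (Measure.pi fun _ : Fin n => μ).withDensity fun x => ∏ i, ENNReal.ofReal (f (x i)) := by
  have : SigmaFinite (μ.withDensity fun x => ENNReal.ofReal (f x)) :=
    inferInstanceAs (SigmaFinite f.toMeasure)
  exact pi_withDensity_eq μ n f.measurable_toFun.ennreal_ofReal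

theorem toMeasure_eq_of_ae_eq {f g : Density μ} (h : f =ᵐ[μ] g) : f.toMeasure = g.toMeasure :=
  withDensity_congr_ae (h.mono fun x hx => by simp only [hx])

theorem ae_toMeasure_iff (f : Density μ) {p : α → Prop} :
    (∀ᵐ x ∂f.toMeasure, p x) ↔ ∀ᵐ x ∂μ, f x ≠ 0 → p x := by
  rw [toMeasure, ae_withDensity_iff f.measurable_toFun.ennreal_ofReal]
  refine eventually_congr (Eventually.of_forall fun x => ?_)
  have : ENNReal.ofReal (f x) ≠ 0 ↔ f x ≠ 0 := by
    rw [Ne, ENNReal.ofReal_eq_zero, not_le]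
    exact ⟨fun h => h.ne', fun h => lt_of_le_of_ne (f.nonneg x) h.symm⟩
  rw [this]

theorem integral_toMeasure (f : Density μ) (φ : α → ℝ) :
    ∫ x, φ x ∂f.toMeasure = ∫ x, f x * φ x ∂μ := by
  rw [toMeasure, integral_withDensity_eq_integral_toReal_smul f.measurable_toFun.ennreal_ofReal
    (ae_of_all _ fun _ => ENNReal.ofReal_lt_top)]
  simp [ENNReal.toReal_ofReal (f.nonneg _)]

theorem integrable_toMeasure_iff (f : Density μ) (φ : α → ℝ) :
    Integrable φ f.toMeasure ↔ Integrable (fun x => f x * φ x) μ := by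
  rw [toMeasure, integrable_withDensity_iff_integrable_smul'
    f.measurable_toFun.ennreal_ofReal (ae_of_all _ fun _ => ENNReal.ofReal_lt_top)]
  simp [ENNReal.toReal_ofReal (f.nonneg _)]

theorem integrable (f : Density μ) : Integrable f μ := by
  refine ⟨f.measurable_toFun.aestronglyMeasurable, ?_⟩
  rw [hasFiniteIntegral_iff_ofReal (ae_of_all _ f.nonneg), f.lintegral_eq_one]
  exact ENNReal.one_lt_top

theorem integral_eq_one (f : Density μ) : ∫ x, f x ∂μ = 1 := by
  rw [integral_eq_lintegral_of_nonneg_ae (ae_of_all _ f.nonneg)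
    f.measurable_toFun.aestronglyMeasurable, f.lintegral_eq_one, ENNReal.toReal_one]

end Density

/-! ### Likelihood ratios in Kullback–Leibler neighbourhoods -/

section Chebyshev

variable {α : Type*} [MeasurableSpace α] {μ : Measure α}

/-- Chebyshev's inequality for the sum of the log ratios: its mean and its variance are both at most
nε², and the event forces it to exceed 2nε², a deviation of at least nε². -/
theorem pi_toMeasure_prod_lt_le {f₀ f : Density μ} {ε : ℝ} (hf : f ∈ klNeighborhood f₀ ε)
    {n : ℕ} (hn : 0 < (n : ℝ) * ε ^ 2) :
    Measure.pi (fun _ : Fin n => f₀.toMeasure)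
      {x | ∏ i, f (x i) < Real.exp (-(2 * (n * ε ^ 2))) * ∏ i, f₀ (x i)} ≤
      ENNReal.ofReal (1 / (n * ε ^ 2)) := by
  obtain ⟨hac, hi1, hi2, hle1, hle2⟩ := hf
  set P := f₀.toMeasure with hP
  set Z : α → ℝ := fun x => Real.log (f₀ x / f x) with hZ
  have hZm : Measurable Z := Real.measurable_log.comp (f₀.measurable_toFun.div f.measurable_toFun)
  have hpos : ∀ᵐ x ∂P, 0 < f₀ x ∧ 0 < f x := by
    rw [hP, Density.ae_toMeasure_iff]
    filter_upwards [hac] with x hx h0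
    exact ⟨lt_of_le_of_ne (f₀.nonneg x) h0.symm,
      lt_of_le_of_ne (f.nonneg x) fun h => h0 (hx h.symm)⟩
  have hZ2 : MemLp Z 2 P := by
    rw [memLp_two_iff_integrable_sq hZm.aestronglyMeasurable, Density.integrable_toMeasure_iff]
    exact hi2
  have hmean : ∫ x, Z x ∂P ≤ ε ^ 2 := by rw [Density.integral_toMeasure]; exact hle1
  have hvar : ProbabilityTheory.variance Z P ≤ ε ^ 2 := by
    refine (ProbabilityTheory.variance_le_expectation_sq hZm.aestronglyMeasurable).trans ?_
    have : ∫ x, (Z ^ 2) x ∂P = ∫ x, f₀ x * (Z x) ^ 2 ∂μ := Density.integral_toMeasure f₀ _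
    rw [this]; exact hle2
  set S : (Fin n → α) → ℝ := ∑ i, fun x => Z (x i) with hS
  have hcoord : ∀ i : Fin n, MemLp (fun x : Fin n → α => Z (x i)) 2 (Measure.pi fun _ => P) :=
    fun i => hZ2.comp_measurePreserving (measurePreserving_eval (fun _ : Fin n => P) i)
  have hSL : MemLp S 2 (Measure.pi fun _ : Fin n => P) := memLp_finsetSum' _ fun i _ => hcoord i
  have hSmean : ∫ x, S x ∂(Measure.pi fun _ : Fin n => P) = n * ∫ x, Z x ∂P := by
    simp only [hS, Finset.sum_apply]
    rw [integral_finsetSum _ fun i _ => (hcoord i).integrable (by norm_num)]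
    have : ∀ i : Fin n, ∫ x, Z (x i) ∂(Measure.pi fun _ : Fin n => P) = ∫ x, Z x ∂P := fun i =>
      integral_comp_eval (μ := fun _ : Fin n => P) (i := i) (f := Z) hZm.aestronglyMeasurable
    simp [this]
  have hSvar : ProbabilityTheory.variance S (Measure.pi fun _ : Fin n => P) ≤ n * ε ^ 2 := by
    rw [hS, ProbabilityTheory.variance_sum_pi (X := fun _ => Z) fun _ => hZ2]
    simp only [Finset.sum_const, Finset.card_univ, Fintype.card_fin, nsmul_eq_mul]
    exact mul_le_mul_of_nonneg_left hvar n.cast_nonneg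
  have hposn : ∀ᵐ x ∂(Measure.pi fun _ : Fin n => P), ∀ i, 0 < f₀ (x i) ∧ 0 < f (x i) := by
    rw [ae_all_iff]
    exact fun i => (Measure.quasiMeasurePreserving_eval (fun _ : Fin n => P) i).ae hpos
  have hcheb := ProbabilityTheory.meas_ge_le_variance_div_sq hSL hn
  refine (measure_mono_ae ?_).trans (hcheb.trans (ENNReal.ofReal_le_ofReal ?_))
  · filter_upwards [hposn] with x hx hlt
    change (n : ℝ) * ε ^ 2 ≤ |S x - _|
    rw [hSmean]
    have hf0 : 0 < ∏ i, f₀ (x i) := Finset.prod_pos fun i _ => (hx i).1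
    have hf1 : 0 < ∏ i, f (x i) := Finset.prod_pos fun i _ => (hx i).2
    have hSx : S x = Real.log (∏ i, f₀ (x i)) - Real.log (∏ i, f (x i)) := by
      rw [Real.log_prod fun i _ => (hx i).1.ne', Real.log_prod fun i _ => (hx i).2.ne',
        ← Finset.sum_sub_distrib]
      simp only [hS, Finset.sum_apply, hZ]
      exact Finset.sum_congr rfl fun i _ => Real.log_div (hx i).1.ne' (hx i).2.ne'
    have h1 : Real.log (∏ i, f (x i)) < -(2 * (n * ε ^ 2)) + Real.log (∏ i, f₀ (x i)) := by
      have := Real.log_lt_log hf1 hlt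
      rwa [Real.log_mul (Real.exp_pos _).ne' hf0.ne', Real.log_exp] at this
    have h2 : (n : ℝ) * ∫ x, Z x ∂P ≤ n * ε ^ 2 := mul_le_mul_of_nonneg_left hmean n.cast_nonneg
    refine le_trans ?_ (le_abs_self _)
    rw [hSx]; linarith
  · rw [div_le_div_iff₀ (by positivity) hn]
    nlinarith

/-- Change of measure from `f₀` to a density in a Kullback–Leibler neighbourhood. -/
theorem exp_mul_pi_toMeasure_le [SigmaFinite μ] {f₀ f : Density μ} {ε : ℝ}
    (hf : f ∈ klNeighborhood f₀ ε) {n : ℕ} (hn : 0 < (n : ℝ) * ε ^ 2) {S : Set (Fin n → α)}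
    (hS : MeasurableSet S) :
    ENNReal.ofReal (Real.exp (-(2 * (n * ε ^ 2)))) *
        (Measure.pi (fun _ : Fin n => f₀.toMeasure) S - ENNReal.ofReal (1 / (n * ε ^ 2))) ≤
      Measure.pi (fun _ : Fin n => f.toMeasure) S := by
  set c := Real.exp (-(2 * (n * ε ^ 2))) with hc
  set E : Set (Fin n → α) := {x | ∏ i, f (x i) < c * ∏ i, f₀ (x i)} with hE
  have hm : ∀ g : Density μ, Measurable fun x : Fin n → α => ∏ i, g (x i) := fun g =>
    Finset.measurable_prod _ fun i _ => g.measurable_toFun.comp (measurable_pi_apply i)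
  have hEm : MeasurableSet E := measurableSet_lt (hm f) ((hm f₀).const_mul c)
  -- Removing `E` costs at most 1/(nε²) in probability under `f₀`. On what remains the likelihood
  -- ratio is bounded below pointwise, so the two product densities can be compared under the
  -- integral.
  have h1 : Measure.pi (fun _ : Fin n => f₀.toMeasure) S - ENNReal.ofReal (1 / (n * ε ^ 2)) ≤
      Measure.pi (fun _ : Fin n => f₀.toMeasure) (S \ E) := by
    refine (tsub_le_tsub_left (pi_toMeasure_prod_lt_le hf hn) _).trans ?_
    exact le_measure_sdiff
  refine (mul_le_mul_right h1 _).trans ((?_ : _ ≤ _).trans (measure_mono (Set.sdiff_subset (t := E))))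
  have hprod : ∀ (g : Density μ) (x : Fin n → α),
      ∏ i, ENNReal.ofReal (g (x i)) = ENNReal.ofReal (∏ i, g (x i)) := fun g x =>
    (ENNReal.ofReal_prod_of_nonneg fun i _ => g.nonneg _).symm
  rw [Density.pi_toMeasure, Density.pi_toMeasure, withDensity_apply _ (hS.diff hEm),
    withDensity_apply _ (hS.diff hEm)]
  simp only [hprod]
  rw [← lintegral_const_mul _ (hm f₀).ennreal_ofReal]
  refine setLIntegral_mono (hm f).ennreal_ofReal fun x hx => ?_
  rw [← ENNReal.ofReal_mul (Real.exp_pos _).le]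
  exact ENNReal.ofReal_le_ofReal (not_lt.1 hx.2)

end Chebyshev

/-! ### The `L₁` and Hellinger distances -/

section Distance

variable {α : Type*} [MeasurableSpace α] {μ : Measure α}

namespace Density

theorem measurable_sqrt (f : Density μ) : Measurable fun x => √(f x) :=
  Real.continuous_sqrt.measurable.comp f.measurable_toFun

theorem memLp_sqrt (f : Density μ) : MemLp (fun x => √(f x)) 2 μ := by
  rw [memLp_two_iff_integrable_sq f.measurable_sqrt.aestronglyMeasurable]
  simpa only [Real.sq_sqrt (f.nonneg _)] using f.integrable

theorem integrable_sqrt_mul_sqrt (f g : Density μ) :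
    Integrable (fun x => √(f x) * √(g x)) μ :=
  f.memLp_sqrt.integrable_mul g.memLp_sqrt

theorem integrable_sqrt_sub_sq (f g : Density μ) :
    Integrable (fun x => (√(f x) - √(g x)) ^ 2) μ :=
  (f.memLp_sqrt.sub g.memLp_sqrt).integrable_sq

theorem integral_sqrt_sub_sq (f g : Density μ) :
    ∫ x, (√(f x) - √(g x)) ^ 2 ∂μ = 2 - 2 * ∫ x, √(f x) * √(g x) ∂μ := by
  have h : ∀ x, (√(f x) - √(g x)) ^ 2 = f x + g x - 2 * (√(f x) * √(g x)) := fun x => by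
    have h1 := Real.sq_sqrt (f.nonneg x)
    have h2 := Real.sq_sqrt (g.nonneg x)
    linear_combination h1 + h2
  have hfg : Integrable (fun x => f x + g x) μ := f.integrable.add g.integrable
  simp_rw [h]
  rw [integral_sub hfg ((f.integrable_sqrt_mul_sqrt g).const_mul 2),
    integral_add f.integrable g.integrable, f.integral_eq_one, g.integral_eq_one,
    integral_const_mul]
  norm_num

end Density

namespace DistanceKind

theorem dist_nonneg (d : DistanceKind) (f g : Density μ) : 0 ≤ d.dist f g := by
  cases d
  · exact integral_nonneg fun x => abs_nonneg _
  · exact Real.sqrt_nonneg _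

theorem dist_comm (d : DistanceKind) (f g : Density μ) : d.dist f g = d.dist g f := by
  cases d
  · simp only [dist, abs_sub_comm]
  · simp only [dist]
    congr 2 with x
    ring

theorem hellinger_sq (f g : Density μ) :
    hellinger.dist f g ^ 2 = ∫ x, (√(f x) - √(g x)) ^ 2 ∂μ :=
  Real.sq_sqrt (integral_nonneg fun _ => sq_nonneg _)

theorem hellinger_eq_toReal_eLpNorm (f g : Density μ) :
    hellinger.dist f g = (eLpNorm ((fun x => √(f x)) - fun x => √(g x)) 2 μ).toReal := by
  rw [(f.memLp_sqrt.sub g.memLp_sqrt).eLpNorm_eq_integral_rpow_norm (by norm_num) (by norm_num),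
    ENNReal.toReal_ofReal (by positivity)]
  simp [dist, Real.sqrt_eq_rpow]

theorem dist_triangle (d : DistanceKind) (f g k : Density μ) :
    d.dist f k ≤ d.dist f g + d.dist g k := by
  cases d
  · simp only [dist]
    have h1 : Integrable (fun x => |f x - g x|) μ := (f.integrable.sub g.integrable).abs
    have h2 : Integrable (fun x => |g x - k x|) μ := (g.integrable.sub k.integrable).abs
    rw [← integral_add h1 h2]
    exact integral_mono (f.integrable.sub k.integrable).abs (h1.add h2) fun x => abs_sub_le _ _ _
  · simp only [hellinger_eq_toReal_eLpNorm]
    have h1 := f.memLp_sqrt.sub g.memLp_sqrt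
    have h2 := g.memLp_sqrt.sub k.memLp_sqrt
    rw [← ENNReal.toReal_add h1.eLpNorm_ne_top h2.eLpNorm_ne_top]
    refine ENNReal.toReal_mono (ENNReal.add_ne_top.2 ⟨h1.eLpNorm_ne_top, h2.eLpNorm_ne_top⟩) ?_
    have := eLpNorm_add_le h1.1 h2.1 (p := 2) (by norm_num)
    rwa [sub_add_sub_cancel] at this

/-- The σ-algebra on densities is generated by integrals over sets, so pointwise evaluation need not
be measurable. Replacing the varying density by the jointly measurable version `L` leaves the
distance unchanged and makes the integral measurable in `f`. -/
theorem measurable_dist [SFinite μ] {L : Density μ → α → ℝ≥0∞} (hL : IsLikelihood L)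
    (d : DistanceKind) (f₀ : Density μ) : Measurable fun f : Density μ => d.dist f f₀ := by
  have hLm : Measurable fun p : Density μ × α => (L p.1 p.2).toReal := hL.measurable.ennreal_toReal
  have hf₀ : Measurable fun p : Density μ × α => f₀ p.2 := f₀.measurable_toFun.comp measurable_snd
  have hae : ∀ f : Density μ, ∀ᵐ y ∂μ, (L f y).toReal = f y := fun f => by
    filter_upwards [hL.ae_eq f] with y hy
    rw [hy, ENNReal.toReal_ofReal (f.nonneg y)]
  cases d
  · have h1 : StronglyMeasurable fun f : Density μ => ∫ y, |(L f y).toReal - f₀ y| ∂μ :=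
      StronglyMeasurable.integral_prod_right (f := fun f y => |(L f y).toReal - f₀ y|)
        (hLm.sub hf₀).abs.stronglyMeasurable
    convert h1.measurable using 2 with f
    refine integral_congr_ae ?_
    filter_upwards [hae f] with y hy
    rw [hy]
  · have h1 : StronglyMeasurable fun f : Density μ => ∫ y, (√(L f y).toReal - √(f₀ y)) ^ 2 ∂μ :=
      StronglyMeasurable.integral_prod_right (f := fun f y => (√(L f y).toReal - √(f₀ y)) ^ 2)
        ((hLm.sqrt.sub hf₀.sqrt).pow_const 2).stronglyMeasurable
    convert h1.measurable.sqrt using 2 with f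
    simp only [dist]
    congr 1
    refine integral_congr_ae ?_
    filter_upwards [hae f] with y hy
    rw [hy]

end DistanceKind

/-! ### Distances decrease under measurable maps -/

variable {β : Type*} [MeasurableSpace β] {ν : Measure β}

/-- Duality: the distance is the integral of a - b against its sign. Pulled back along `h`, the sign
is still bounded by one, so it gives a lower bound for the distance upstairs. -/
theorem l1_dist_le_of_map {h : α → β} (hh : Measurable h) {f c : Density μ} {a b : Density ν}
    (ha : a.toMeasure = f.toMeasure.map h) (hb : b.toMeasure = c.toMeasure.map h) :
    DistanceKind.l1.dist a b ≤ DistanceKind.l1.dist f c := by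
  classical
  set s : β → ℝ := fun y => if a y < b y then -1 else 1 with hs
  have hsm : Measurable s :=
    Measurable.ite (measurableSet_lt a.measurable_toFun b.measurable_toFun) measurable_const
      measurable_const
  have hs1 : ∀ y, |s y| ≤ 1 := fun y => by simp only [hs]; split_ifs <;> simp
  have hab : ∀ y, |a y - b y| = a y * s y - b y * s y := fun y => by
    simp only [hs]
    split_ifs with hy
    · rw [abs_of_neg (by linarith)]; ring
    · rw [abs_of_nonneg (by linarith [not_lt.1 hy])]; ring
  have hint : ∀ k : Density ν, Integrable (fun y => k y * s y) ν := fun k =>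
    k.integrable.mul_bdd (c := 1) hsm.aestronglyMeasurable (ae_of_all _ hs1)
  have hint' : ∀ k : Density μ, Integrable (fun x => k x * s (h x)) μ := fun k =>
    k.integrable.mul_bdd (c := 1) (hsm.comp hh).aestronglyMeasurable (ae_of_all _ fun x => hs1 _)
  have hpush : ∀ (k : Density ν) (l : Density μ), k.toMeasure = l.toMeasure.map h →
      ∫ y, k y * s y ∂ν = ∫ x, l x * s (h x) ∂μ := fun k l hkl => by
    rw [← k.integral_toMeasure, hkl, integral_map hh.aemeasurable hsm.aestronglyMeasurable,
      l.integral_toMeasure]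
  simp only [DistanceKind.dist]
  simp_rw [hab]
  rw [integral_sub (hint a) (hint b), hpush a f ha, hpush b c hb,
    ← integral_sub (hint' f) (hint' c)]
  refine integral_mono ((hint' f).sub (hint' c)) (f.integrable.sub c.integrable).abs fun x => ?_
  simp only
  rw [← sub_mul]
  refine (le_abs_self _).trans ?_
  rw [abs_mul]
  exact mul_le_of_le_one_right (abs_nonneg _) (hs1 _)

/-- Weighted arithmetic–geometric mean: 2√f√c ≤ f·w + c/w with w = √(b∘h)/√(a∘h). Since w is a
function of `h`, each term on the right integrates to the affinity of a and b. -/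
theorem affinity_le_of_map {h : α → β} (hh : Measurable h) {f c : Density μ} {a b : Density ν}
    (ha : a.toMeasure = f.toMeasure.map h) (hb : b.toMeasure = c.toMeasure.map h) :
    ∫ x, √(f x) * √(c x) ∂μ ≤ ∫ y, √(a y) * √(b y) ∂ν := by
  have key : ∀ (a b : Density ν) (f : Density μ), a.toMeasure = f.toMeasure.map h →
      (∀ᵐ x ∂μ, f x ≠ 0 → a (h x) ≠ 0) ∧
      Integrable (fun x => f x * (√(b (h x)) / √(a (h x)))) μ ∧
      ∫ x, f x * (√(b (h x)) / √(a (h x))) ∂μ = ∫ y, √(a y) * √(b y) ∂ν := by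
    intro a b f ha
    have hm : Measurable fun y => √(b y) / √(a y) := b.measurable_sqrt.div a.measurable_sqrt
    -- Also valid where a vanishes, both sides being 0.
    have he : ∀ y, a y * (√(b y) / √(a y)) = √(a y) * √(b y) := fun y => by
      rw [mul_div_left_comm, Real.div_sqrt, mul_comm]
    refine ⟨?_, ?_, ?_⟩
    · have h0 : ∀ᵐ y ∂a.toMeasure, a y ≠ 0 := by
        rw [Density.ae_toMeasure_iff]; exact ae_of_all _ fun _ h => h
      rw [ha] at h0
      exact (f.ae_toMeasure_iff).1 (ae_of_ae_map hh.aemeasurable h0)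
    · rw [← f.integrable_toMeasure_iff (fun x => √(b (h x)) / √(a (h x)))]
      have : Integrable (fun y => √(b y) / √(a y)) a.toMeasure := by
        rw [Density.integrable_toMeasure_iff]
        simp_rw [he]
        exact a.integrable_sqrt_mul_sqrt b
      rw [ha] at this
      exact (integrable_map_measure hm.aestronglyMeasurable hh.aemeasurable).1 this
    · rw [← f.integral_toMeasure, ← integral_map (f := fun y => √(b y) / √(a y)) hh.aemeasurable
        hm.aestronglyMeasurable, ← ha, a.integral_toMeasure]
      simp_rw [he]
  obtain ⟨h1, h2, h3⟩ := key a b f ha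
  obtain ⟨h4, h5, h6⟩ := key b a c hb
  have h6' : ∫ x, c x * (√(a (h x)) / √(b (h x))) ∂μ = ∫ y, √(a y) * √(b y) ∂ν := by
    rw [h6]; simp_rw [mul_comm]
  have hle : ∀ᵐ x ∂μ, 2 * (√(f x) * √(c x)) ≤
      f x * (√(b (h x)) / √(a (h x))) + c x * (√(a (h x)) / √(b (h x))) := by
    filter_upwards [h1, h4] with x hx1 hx4
    by_cases hf : f x = 0
    · rw [hf]; simp only [Real.sqrt_zero, zero_mul, mul_zero, zero_add]
      exact mul_nonneg (c.nonneg x) (by positivity)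
    by_cases hc : c x = 0
    · rw [hc]; simp only [Real.sqrt_zero, zero_mul, mul_zero, add_zero]
      exact mul_nonneg (f.nonneg x) (by positivity)
    have ha0 : 0 < √(a (h x)) := Real.sqrt_pos.2 (lt_of_le_of_ne (a.nonneg _) (hx1 hf).symm)
    have hb0 : 0 < √(b (h x)) := Real.sqrt_pos.2 (lt_of_le_of_ne (b.nonneg _) (hx4 hc).symm)
    have hfs := Real.sq_sqrt (f.nonneg x)
    have hcs := Real.sq_sqrt (c.nonneg x)
    have e : f x * (√(b (h x)) / √(a (h x))) + c x * (√(a (h x)) / √(b (h x))) -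
        2 * (√(f x) * √(c x)) =
        (√(f x) * √(b (h x)) - √(c x) * √(a (h x))) ^ 2 / (√(a (h x)) * √(b (h x))) := by
      rw [← hfs, ← hcs]
      simp only [Real.sqrt_sq (Real.sqrt_nonneg _)]
      field_simp
      ring
    have : 0 ≤ (√(f x) * √(b (h x)) - √(c x) * √(a (h x))) ^ 2 / (√(a (h x)) * √(b (h x))) := by
      positivity
    linarith
  have := integral_mono_ae ((f.integrable_sqrt_mul_sqrt c).const_mul 2) (h2.add h5) hle
  rw [integral_const_mul] at this
  have h7 := integral_add h2 h5
  simp only [Pi.add_apply] at this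
  linarith

theorem dist_le_of_map (d : DistanceKind) {h : α → β} (hh : Measurable h) {f c : Density μ}
    {a b : Density ν} (ha : a.toMeasure = f.toMeasure.map h)
    (hb : b.toMeasure = c.toMeasure.map h) : d.dist a b ≤ d.dist f c := by
  cases d
  · exact l1_dist_le_of_map hh ha hb
  · refine Real.sqrt_le_sqrt ?_
    rw [a.integral_sqrt_sub_sq, f.integral_sqrt_sub_sq]
    linarith [affinity_le_of_map hh ha hb]

end Distance

/-! ### Tests between a density and a ball -/

section Test

variable {α : Type*} [MeasurableSpace α] {μ : Measure α}

/-- The bounded test statistic `(3 √f₀ + √f₁) / (√f₀ + 3 √f₁)`, set to one where `f₀ = f₁ = 0`. -/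
def sqrtRatio (f₀ f₁ : Density μ) (x : α) : ℝ :=
  1 + 2 * (√(f₀ x) - √(f₁ x)) / (3 * √(f₁ x) + √(f₀ x))

theorem measurable_sqrtRatio (f₀ f₁ : Density μ) : Measurable (sqrtRatio f₀ f₁) :=
  measurable_const.add (((f₀.measurable_sqrt.sub f₁.measurable_sqrt).const_mul 2).div
    ((f₁.measurable_sqrt.const_mul 3).add f₀.measurable_sqrt))

theorem sqrtRatio_eq {f₀ f₁ : Density μ} {x : α} (h : 0 < 3 * √(f₁ x) + √(f₀ x)) :
    sqrtRatio f₀ f₁ x = (3 * √(f₀ x) + √(f₁ x)) / (3 * √(f₁ x) + √(f₀ x)) := by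
  rw [sqrtRatio, eq_div_iff h.ne', add_mul, div_mul_cancel₀ _ h.ne']
  ring

theorem sqrtRatio_eq_one {f₀ f₁ : Density μ} {x : α} (h : ¬ 0 < 3 * √(f₁ x) + √(f₀ x)) :
    √(f₀ x) = 0 ∧ √(f₁ x) = 0 ∧ sqrtRatio f₀ f₁ x = 1 := by
  have h0 := Real.sqrt_nonneg (f₀ x)
  have h1 := Real.sqrt_nonneg (f₁ x)
  have e0 : √(f₀ x) = 0 := by linarith
  have e1 : √(f₁ x) = 0 := by linarith
  exact ⟨e0, e1, by simp [sqrtRatio, e0, e1]⟩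

theorem sqrtRatio_pos (f₀ f₁ : Density μ) (x : α) : 0 < sqrtRatio f₀ f₁ x := by
  by_cases h : 0 < 3 * √(f₁ x) + √(f₀ x)
  · rw [sqrtRatio_eq h]
    have h0 := Real.sqrt_nonneg (f₀ x)
    have h1 := Real.sqrt_nonneg (f₁ x)
    exact div_pos (by linarith) h
  · rw [(sqrtRatio_eq_one h).2.2]; exact one_pos

theorem sqrtRatio_le (f₀ f₁ : Density μ) (x : α) : sqrtRatio f₀ f₁ x ≤ 3 := by
  by_cases h : 0 < 3 * √(f₁ x) + √(f₀ x)
  · rw [sqrtRatio_eq h, div_le_iff₀ h]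
    linarith [Real.sqrt_nonneg (f₁ x)]
  · rw [(sqrtRatio_eq_one h).2.2]; norm_num

/-- This symmetry makes the error under `f₀` an instance of the error under the alternative, with
the two centres exchanged. -/
theorem sqrtRatio_inv (f₀ f₁ : Density μ) (x : α) :
    (sqrtRatio f₀ f₁ x)⁻¹ = sqrtRatio f₁ f₀ x := by
  by_cases h : 0 < 3 * √(f₁ x) + √(f₀ x)
  · have h' : 0 < 3 * √(f₀ x) + √(f₁ x) := by
      have h0 := Real.sqrt_nonneg (f₀ x)
      have h1 := Real.sqrt_nonneg (f₁ x)
      linarith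
    rw [sqrtRatio_eq h, sqrtRatio_eq h', inv_div]
  · obtain ⟨h0, h1, h2⟩ := sqrtRatio_eq_one h
    rw [h2]; simp [sqrtRatio, h0, h1]

/-- Write u, a, b for the roots of f, f₀, f₁. The ratio minus one is 2(a-b)/(3b+a), and u² = b² +
2b(u-b) + (u-b)² is expanded around f₁. The b² term gives the useful negative part after
integration; boundedness of the ratio controls the quadratic term by 2(u-b)²; the cross term is
split by Young's inequality. Thus 38/3 = 32/3 + 2. -/
theorem mul_sqrtRatio_le (f f₀ f₁ : Density μ) (x : α) :
    f x * sqrtRatio f₀ f₁ x ≤ f x + 1 / 2 * (√(f₀ x) * √(f₁ x) - f₁ x) +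
      38 / 3 * (√(f x) - √(f₁ x)) ^ 2 + 1 / 24 * (√(f₁ x) - √(f₀ x)) ^ 2 := by
  by_cases h : 0 < 3 * √(f₁ x) + √(f₀ x)
  · have hf := Real.sq_sqrt (f.nonneg x)
    have hf1 := Real.sq_sqrt (f₁.nonneg x)
    rw [sqrtRatio_eq h, ← hf, ← hf1]
    simp only [Real.sqrt_sq (Real.sqrt_nonneg _)]
    have h0 := Real.sqrt_nonneg (f₀ x)
    have h1 := Real.sqrt_nonneg (f₁ x)
    have hu := Real.sqrt_nonneg (f x)
    generalize √(f x) = u at *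
    generalize √(f₀ x) = a at *
    generalize √(f₁ x) = b at *
    have e1 : b ^ 2 * (2 * (a - b) / (3 * b + a)) ≤ 1 / 2 * (a * b - b ^ 2) := by
      rw [mul_div_assoc', div_le_iff₀ h]
      nlinarith [mul_nonneg h1 (sq_nonneg (a - b))]
    have e2 : (u - b) ^ 2 * (2 * (a - b) / (3 * b + a)) ≤ 2 * (u - b) ^ 2 := by
      rw [mul_comm]
      refine mul_le_mul_of_nonneg_right ?_ (sq_nonneg _)
      rw [div_le_iff₀ h]; linarith
    have e3 : 2 * b * (u - b) * (2 * (a - b) / (3 * b + a)) ≤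
        32 / 3 * (u - b) ^ 2 + 1 / 24 * (b - a) ^ 2 := by
      have hr0 : 0 ≤ b / (3 * b + a) := div_nonneg h1 h.le
      have hr1 : b / (3 * b + a) ≤ 1 / 3 := by rw [div_le_iff₀ h]; linarith
      have hr : 2 * b * (u - b) * (2 * (a - b) / (3 * b + a)) =
          b / (3 * b + a) * (4 * ((u - b) * (a - b))) := by ring
      rw [hr]
      -- The difference of the two sides is (16(u-b) - (a-b))²/8.
      have h3 : 4 * ((u - b) * (a - b)) ≤ 32 * (u - b) ^ 2 + 1 / 8 * (b - a) ^ 2 := by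
        nlinarith [sq_nonneg (16 * (u - b) - (a - b))]
      have h4 : 0 ≤ 32 * (u - b) ^ 2 + 1 / 8 * (b - a) ^ 2 := by positivity
      calc _ ≤ b / (3 * b + a) * (32 * (u - b) ^ 2 + 1 / 8 * (b - a) ^ 2) :=
            mul_le_mul_of_nonneg_left h3 hr0
        _ ≤ 1 / 3 * (32 * (u - b) ^ 2 + 1 / 8 * (b - a) ^ 2) :=
            mul_le_mul_of_nonneg_right hr1 h4
        _ = _ := by ring
    have e : u ^ 2 * ((3 * a + b) / (3 * b + a)) = u ^ 2 +
        (b ^ 2 * (2 * (a - b) / (3 * b + a)) + 2 * b * (u - b) * (2 * (a - b) / (3 * b + a)) +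
          (u - b) ^ 2 * (2 * (a - b) / (3 * b + a))) := by
      field_simp
      ring
    rw [e]
    linarith
  · obtain ⟨h0, h1, h2⟩ := sqrtRatio_eq_one h
    have hf := Real.sq_sqrt (f.nonneg x)
    have hf1 := Real.sq_sqrt (f₁.nonneg x)
    rw [h2, ← hf1, h0, h1]
    nlinarith [sq_nonneg (√(f x))]

/-- With δ the distance of the centres, the affinity term of `mul_sqrtRatio_le` integrates to -δ²/4,
while the error terms give at most (38/3)/256 + 1/24 = 35/384 times δ². The total is below 1 - δ²/16
≤ exp(-δ²/16). -/
theorem lintegral_sqrtRatio_le {f f₀ f₁ : Density μ}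
    (hf : DistanceKind.hellinger.dist f f₁ ≤ DistanceKind.hellinger.dist f₁ f₀ / 16) :
    ∫⁻ x, ENNReal.ofReal (sqrtRatio f₀ f₁ x) ∂f.toMeasure ≤
      ENNReal.ofReal (Real.exp (-(DistanceKind.hellinger.dist f₁ f₀ ^ 2 / 16))) := by
  have hi : Integrable (sqrtRatio f₀ f₁) f.toMeasure :=
    Integrable.of_bound (measurable_sqrtRatio f₀ f₁).aestronglyMeasurable 3 <| ae_of_all _ fun x => by
      rw [Real.norm_of_nonneg (sqrtRatio_pos f₀ f₁ x).le]; exact sqrtRatio_le f₀ f₁ x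
  rw [← ofReal_integral_eq_lintegral_ofReal hi (ae_of_all _ fun x => (sqrtRatio_pos f₀ f₁ x).le)]
  refine ENNReal.ofReal_le_ofReal ?_
  have hsq : DistanceKind.hellinger.dist f f₁ ^ 2 ≤
      DistanceKind.hellinger.dist f₁ f₀ ^ 2 / 256 := by
    have := pow_le_pow_left₀ (DistanceKind.dist_nonneg _ _ _) hf 2
    linarith [div_pow (DistanceKind.hellinger.dist f₁ f₀) 16 2]
  have hi1 : Integrable (fun x => 1 / 2 * (√(f₀ x) * √(f₁ x) - f₁ x)) μ :=
    ((f₀.integrable_sqrt_mul_sqrt f₁).sub f₁.integrable).const_mul _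
  have hi2 : Integrable (fun x => 38 / 3 * (√(f x) - √(f₁ x)) ^ 2) μ :=
    (f.integrable_sqrt_sub_sq f₁).const_mul _
  have hi3 : Integrable (fun x => 1 / 24 * (√(f₁ x) - √(f₀ x)) ^ 2) μ :=
    (f₁.integrable_sqrt_sub_sq f₀).const_mul _
  have hi4 : Integrable (fun x => f x + 1 / 2 * (√(f₀ x) * √(f₁ x) - f₁ x)) μ :=
    f.integrable.add hi1
  have hi5 : Integrable (fun x => f x + 1 / 2 * (√(f₀ x) * √(f₁ x) - f₁ x) +
      38 / 3 * (√(f x) - √(f₁ x)) ^ 2) μ := hi4.add hi2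
  have hle := integral_mono ((f.integrable_toMeasure_iff _).1 hi) (hi5.add hi3)
    fun x => mul_sqrtRatio_le f f₀ f₁ x
  rw [f.integral_toMeasure]
  refine hle.trans ?_
  rw [integral_add' hi5 hi3, integral_add hi4 hi2, integral_add f.integrable hi1, integral_const_mul,
    integral_sub (f₀.integrable_sqrt_mul_sqrt f₁) f₁.integrable, integral_const_mul,
    integral_const_mul, f.integral_eq_one, f₁.integral_eq_one, ← DistanceKind.hellinger_sq,
    ← DistanceKind.hellinger_sq]
  have haff := f₁.integral_sqrt_sub_sq f₀
  rw [← DistanceKind.hellinger_sq] at haff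
  have hcomm : ∫ x, √(f₀ x) * √(f₁ x) ∂μ = ∫ x, √(f₁ x) * √(f₀ x) ∂μ := by simp_rw [mul_comm]
  have hexp := Real.add_one_le_exp (-(DistanceKind.hellinger.dist f₁ f₀ ^ 2 / 16))
  rw [hcomm]
  nlinarith [sq_nonneg (DistanceKind.hellinger.dist f₁ f₀)]

/-- Hoeffding's lemma: a variable with values in [0, 1] is sub-Gaussian with parameter 1/4, whence
t²/8. -/
theorem lintegral_exp_mul_indicator_sub_le (P : Measure α) [IsProbabilityMeasure P] {A : Set α}
    (hA : MeasurableSet A) (t θ : ℝ) :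
    ∫⁻ x, ENNReal.ofReal (Real.exp (t * (A.indicator 1 x - θ))) ∂P ≤
      ENNReal.ofReal (Real.exp (t ^ 2 / 8 + t * (P.real A - θ))) := by
  have hm : Measurable (A.indicator (1 : α → ℝ)) := measurable_one.indicator hA
  have hsub := ProbabilityTheory.hasSubgaussianMGF_of_mem_Icc (μ := P) (a := 0) (b := 1)
    hm.aemeasurable (ae_of_all _ fun x => by
      by_cases hx : x ∈ A <;> simp [hx])
  have hmean : ∫ x, A.indicator (1 : α → ℝ) x ∂P = P.real A := integral_indicator_one hA
  rw [hmean] at hsub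
  have hsplit : ∀ x, Real.exp (t * (A.indicator 1 x - θ)) =
      Real.exp (t * (P.real A - θ)) * Real.exp (t * (A.indicator 1 x - P.real A)) := fun x => by
    rw [← Real.exp_add]; congr 1; ring
  simp_rw [hsplit]
  rw [← ofReal_integral_eq_lintegral_ofReal ((hsub.integrable_exp_mul t).const_mul _)
    (ae_of_all _ fun x => by positivity), integral_const_mul]
  refine ENNReal.ofReal_le_ofReal ?_
  rw [add_comm, Real.exp_add]
  refine mul_le_mul_of_nonneg_left ((hsub.mgf_le t).trans_eq ?_) (Real.exp_pos _).le
  congr 1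
  simp
  ring

theorem toMeasure_real_eq (f : Density μ) {A : Set α} (hA : MeasurableSet A) :
    f.toMeasure.real A = ∫ x in A, f x ∂μ := by
  rw [← integral_indicator_one hA, f.integral_toMeasure, ← integral_indicator hA]
  congr 1 with x
  by_cases hx : x ∈ A <;> simp [hx]

/-- For each of the two distances, a test statistic that separates `f₀` from a ball around `f₁`
whose radius is a fixed fraction of the distance of the centres. -/
theorem exists_test_statistic (d : DistanceKind) (f₀ f₁ : Density μ) :
    ∃ ψ : α → ℝ, Measurable ψ ∧ (∀ x, 0 < ψ x) ∧
      ∫⁻ x, ENNReal.ofReal (ψ x)⁻¹ ∂f₀.toMeasure ≤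
        ENNReal.ofReal (Real.exp (-(d.dist f₁ f₀ ^ 2 / 16))) ∧
      ∀ f : Density μ, d.dist f f₁ ≤ d.dist f₁ f₀ / 16 →
        ∫⁻ x, ENNReal.ofReal (ψ x) ∂f.toMeasure ≤
          ENNReal.ofReal (Real.exp (-(d.dist f₁ f₀ ^ 2 / 16))) := by
  cases d
  · set δ := DistanceKind.l1.dist f₁ f₀ with hδ
    have hδ0 : 0 ≤ δ := DistanceKind.dist_nonneg _ _ _
    set A : Set α := {x | f₀ x < f₁ x} with hAdef
    have hA : MeasurableSet A := measurableSet_lt f₀.measurable_toFun f₁.measurable_toFun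
    -- `A` is the Scheffé set, on which f₁ exceeds f₀ by mass δ/2. A density within δ/16 of f₁ still
    -- exceeds f₀ there by 7δ/16, and θ is the midpoint. With t = δ/2 both exponents are at most
    -- δ²/32 - 7δ²/64 = -5δ²/64.
    set θ := f₀.toMeasure.real A + 7 * δ / 32 with hθ
    have hm : Measurable (A.indicator (1 : α → ℝ)) := measurable_one.indicator hA
    have hgap : f₁.toMeasure.real A - f₀.toMeasure.real A = δ / 2 := by
      rw [toMeasure_real_eq _ hA, toMeasure_real_eq _ hA,
        ← integral_sub f₁.integrable.integrableOn f₀.integrable.integrableOn]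
      have hi : Integrable (fun x => f₁ x - f₀ x) μ := f₁.integrable.sub f₀.integrable
      have h1 : δ = (∫ x in A, (f₁ x - f₀ x) ∂μ) - ∫ x in Aᶜ, (f₁ x - f₀ x) ∂μ := by
        rw [hδ, DistanceKind.dist, ← integral_add_compl hA hi.abs, sub_eq_add_neg, ← integral_neg]
        congr 1
        · exact setIntegral_congr_fun hA fun x hx => abs_of_pos (sub_pos.2 hx)
        · exact setIntegral_congr_fun hA.compl fun x hx =>
            abs_of_nonpos (sub_nonpos.2 (not_lt.1 hx))
      have h2 : (∫ x in A, (f₁ x - f₀ x) ∂μ) + ∫ x in Aᶜ, (f₁ x - f₀ x) ∂μ = 0 := by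
        rw [integral_add_compl hA hi, integral_sub f₁.integrable f₀.integrable,
          f₁.integral_eq_one, f₀.integral_eq_one, sub_self]
      linarith
    refine ⟨fun x => Real.exp (-(δ / 2) * (A.indicator 1 x - θ)), ?_, fun x => Real.exp_pos _, ?_, ?_⟩
    · exact Real.measurable_exp.comp ((hm.sub_const θ).const_mul _)
    · have h := lintegral_exp_mul_indicator_sub_le f₀.toMeasure hA (δ / 2) θ
      simp_rw [← Real.exp_neg, neg_mul, neg_neg]
      refine h.trans (ENNReal.ofReal_le_ofReal (Real.exp_le_exp.2 ?_))
      rw [hθ]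
      nlinarith
    · intro f hf
      refine (lintegral_exp_mul_indicator_sub_le f.toMeasure hA (-(δ / 2)) θ).trans
        (ENNReal.ofReal_le_ofReal (Real.exp_le_exp.2 ?_))
      have h1 : f₁.toMeasure.real A - f.toMeasure.real A ≤ DistanceKind.l1.dist f f₁ := by
        rw [toMeasure_real_eq _ hA, toMeasure_real_eq _ hA,
          ← integral_sub f₁.integrable.integrableOn f.integrable.integrableOn,
          DistanceKind.dist_comm]
        have hi : Integrable (fun x => f₁ x - f x) μ := f₁.integrable.sub f.integrable
        refine (integral_mono hi.integrableOn hi.abs.integrableOn fun x => le_abs_self _).trans ?_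
        exact setIntegral_le_integral hi.abs (ae_of_all _ fun x => abs_nonneg _)
      have h2 : 7 * δ / 32 ≤ f.toMeasure.real A - θ := by
        rw [hθ]; linarith
      nlinarith [mul_le_mul_of_nonneg_left h2 hδ0]
  · refine ⟨sqrtRatio f₀ f₁, measurable_sqrtRatio f₀ f₁, sqrtRatio_pos f₀ f₁, ?_, fun f hf =>
      lintegral_sqrtRatio_le hf⟩
    simp_rw [sqrtRatio_inv]
    rw [DistanceKind.dist_comm]
    refine lintegral_sqrtRatio_le ?_
    have : DistanceKind.hellinger.dist f₀ f₀ = 0 := by simp [DistanceKind.dist]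
    rw [this]
    exact div_nonneg (DistanceKind.dist_nonneg _ _ _) (by norm_num)

end Test

/-! ### Marginal likelihoods and posteriors -/

section Posterior

variable {α : Type*} [MeasurableSpace α] {μ : Measure α}

namespace IsLikelihood

variable {L : Density μ → α → ℝ≥0∞}

theorem measurable_prod (hL : IsLikelihood L) (n : ℕ) :
    Measurable fun p : Density μ × (Fin n → α) => ∏ i, L p.1 (p.2 i) :=
  Finset.measurable_prod _ fun i _ => hL.measurable.comp
    (measurable_fst.prodMk ((measurable_pi_apply i).comp measurable_snd))

theorem measurable_marginal (hL : IsLikelihood L) (n : ℕ) (P : Measure (Density μ)) [SFinite P] :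
    Measurable fun y : Fin n → α => ∫⁻ f, ∏ i, L f (y i) ∂P :=
  Measurable.lintegral_prod_right (f := fun (y : Fin n → α) (f : Density μ) => ∏ i, L f (y i))
    ((hL.measurable_prod n).comp measurable_swap)

theorem pi_toMeasure [SigmaFinite μ] (hL : IsLikelihood L) (f : Density μ) (n : ℕ) :
    Measure.pi (fun _ : Fin n => f.toMeasure) =
      (Measure.pi fun _ : Fin n => μ).withDensity fun y => ∏ i, L f (y i) := by
  have h : f.toMeasure = μ.withDensity (L f) := (withDensity_congr_ae (hL.ae_eq f)).symm
  have : SigmaFinite (μ.withDensity (L f)) := h ▸ inferInstance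
  rw [h]
  exact pi_withDensity_eq μ n (hL.measurable.comp measurable_prodMk_left)

theorem measurable_pi_toMeasure_apply [SigmaFinite μ] (hL : IsLikelihood L) (n : ℕ)
    {S : Set (Fin n → α)} (hS : MeasurableSet S) :
    Measurable fun f : Density μ => Measure.pi (fun _ : Fin n => f.toMeasure) S := by
  simp_rw [hL.pi_toMeasure, withDensity_apply _ hS]
  exact Measurable.lintegral_prod_right (f := fun (f : Density μ) (y : Fin n → α) => ∏ i, L f (y i)) (hL.measurable_prod n)

/-- Fubini. This lets marginal likelihoods be handled through probabilities of events under each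
single density. -/
theorem setLIntegral_marginal [SigmaFinite μ] (hL : IsLikelihood L) (n : ℕ)
    (P : Measure (Density μ)) [SFinite P] {S : Set (Fin n → α)} (hS : MeasurableSet S) :
    ∫⁻ y in S, ∫⁻ f, ∏ i, L f (y i) ∂P ∂(Measure.pi fun _ : Fin n => μ) =
      ∫⁻ f, Measure.pi (fun _ : Fin n => f.toMeasure) S ∂P := by
  rw [lintegral_lintegral_swap (f := fun (y : Fin n → α) (f : Density μ) => ∏ i, L f (y i))
    ((hL.measurable_prod n).comp measurable_swap).aemeasurable]
  refine lintegral_congr fun f => ?_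
  rw [hL.pi_toMeasure, withDensity_apply _ hS]

end IsLikelihood

/-- Resolves the self-bounding inequality for the probability of a small marginal likelihood. -/
theorem ENNReal.le_two_mul_of_mul_tsub_le {c x e : ℝ≥0∞} (hc0 : c ≠ 0) (hc : c ≠ ∞) (hx : x ≠ ∞)
    (h : c * (x - e) ≤ c / 2 * x) : x ≤ 2 * e := by
  have h1 : x - e ≤ x / 2 := by
    rw [← ENNReal.mul_le_mul_iff_right hc0 hc]
    refine h.trans_eq ?_
    rw [div_eq_mul_inv, div_eq_mul_inv]; ring
  have h2 : x / 2 + x / 2 ≤ x / 2 + e := by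
    rw [ENNReal.add_halves]; exact tsub_le_iff_right.1 h1
  have h3 : x / 2 ≤ e := (ENNReal.add_le_add_iff_left (ENNReal.div_ne_top hx (by simp))).1 h2
  calc x = x / 2 + x / 2 := (ENNReal.add_halves x).symm
    _ ≤ e + e := add_le_add h3 h3
    _ = 2 * e := (two_mul e).symm

/-- Lower bound for the marginal likelihood: it holds for the coarsened sample if the prior on the
densities of the full sample charges a Kullback–Leibler neighbourhood. -/
theorem pi_marginal_lt_le {β : Type*} [MeasurableSpace β] {ν : Measure β} [SigmaFinite μ]
    [SigmaFinite ν] {h : α → β} (hh : Measurable h) {G : Density μ → Density ν} (hGm : Measurable G)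
    (hG : ∀ f, (G f).toMeasure = f.toMeasure.map h) {f₀star : Density μ} {f₀ : Density ν}
    (hf₀ : f₀.toMeasure = f₀star.toMeasure.map h) {L : Density ν → β → ℝ≥0∞} (hL : IsLikelihood L)
    (P : Measure (Density μ)) [IsProbabilityMeasure P] {ε : ℝ} {n : ℕ} (hn : 0 < (n : ℝ) * ε ^ 2)
    {b : ℝ≥0∞} (hb0 : b ≠ 0) (hb : b ≤ P (klNeighborhood f₀star ε)) :
    Measure.pi (fun _ : Fin n => f₀.toMeasure)
      {y | ∫⁻ f, ∏ i, L f (y i) ∂(P.map G) <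
        ENNReal.ofReal (Real.exp (-(2 * (n * ε ^ 2)))) * b / 2 *
          ∏ i, ENNReal.ofReal (f₀ (y i))} ≤ 2 * ENNReal.ofReal (1 / (n * ε ^ 2)) := by
  have : IsProbabilityMeasure (P.map G) := Measure.isProbabilityMeasure_map hGm.aemeasurable
  set c := ENNReal.ofReal (Real.exp (-(2 * (n * ε ^ 2)))) with hc
  set S : Set (Fin n → β) := {y | ∫⁻ f, ∏ i, L f (y i) ∂(P.map G) <
    c * b / 2 * ∏ i, ENNReal.ofReal (f₀ (y i))} with hSdef
  have hp : Measurable fun y : Fin n → β => ∏ i, ENNReal.ofReal (f₀ (y i)) :=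
    Finset.measurable_prod _ fun i _ =>
      (f₀.measurable_toFun.comp (measurable_pi_apply i)).ennreal_ofReal
  have hS : MeasurableSet S := measurableSet_lt (hL.measurable_marginal n _) (hp.const_mul _)
  -- Events of the rounded sample are pulled back to the latent sample, where the Kullback–Leibler
  -- condition applies.
  have hmap : ∀ (k : Density ν) (l : Density μ), k.toMeasure = l.toMeasure.map h →
      Measure.pi (fun _ : Fin n => k.toMeasure) S =
        Measure.pi (fun _ : Fin n => l.toMeasure) ((fun x i => h (x i)) ⁻¹' S) := by
    intro k l hkl
    have hpr : IsProbabilityMeasure (l.toMeasure.map h) :=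
      Measure.isProbabilityMeasure_map hh.aemeasurable
    rw [hkl, ← Measure.pi_map_pi (μ := fun _ : Fin n => l.toMeasure) fun _ => hh.aemeasurable,
      Measure.map_apply (by fun_prop) hS]
  have hS' : MeasurableSet ((fun (x : Fin n → α) i => h (x i)) ⁻¹' S) :=
    (by fun_prop : Measurable fun (x : Fin n → α) i => h (x i)) hS
  have hFm : Measurable fun f : Density μ => Measure.pi (fun _ : Fin n => (G f).toMeasure) S :=
    (hL.measurable_pi_toMeasure_apply n hS).comp hGm
  have hbtop : b ≠ ∞ := (hb.trans_lt (measure_lt_top _ _)).ne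
  refine ENNReal.le_two_mul_of_mul_tsub_le (c := c * b)
    (mul_ne_zero (ENNReal.ofReal_pos.2 (Real.exp_pos _)).ne' hb0)
    (ENNReal.mul_ne_top ENNReal.ofReal_ne_top hbtop) (measure_ne_top _ _) ?_
  -- The prior average of the probability of `S` is computed twice: from below by the change of
  -- measure on the neighbourhood, from above by Fubini and the definition of `S`. The factor 1/2 in
  -- `S` leaves the slack between the two. Markov's inequality is applied to a measurable function
  -- of `f`, so the neighbourhood itself need not be measurable.
  calc c * b * (Measure.pi (fun _ : Fin n => f₀.toMeasure) S - ENNReal.ofReal (1 / (n * ε ^ 2)))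
      = c * (Measure.pi (fun _ : Fin n => f₀.toMeasure) S - ENNReal.ofReal (1 / (n * ε ^ 2))) *
          b := by ring
    _ ≤ ∫⁻ f, Measure.pi (fun _ : Fin n => (G f).toMeasure) S ∂P := by
        refine le_trans ?_ (mul_meas_ge_le_lintegral hFm
          (c * (Measure.pi (fun _ : Fin n => f₀.toMeasure) S - ENNReal.ofReal (1 / (n * ε ^ 2)))))
        gcongr
        refine hb.trans (measure_mono fun f hf => ?_)
        simp only [Set.mem_ofPred_eq]
        rw [hmap _ _ hf₀, hmap _ _ (hG f)]
        exact exp_mul_pi_toMeasure_le hf hn hS'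
    _ = ∫⁻ f, Measure.pi (fun _ : Fin n => f.toMeasure) S ∂(P.map G) :=
        (lintegral_map (hL.measurable_pi_toMeasure_apply n hS) hGm).symm
    _ = ∫⁻ y in S, ∫⁻ f, ∏ i, L f (y i) ∂(P.map G) ∂(Measure.pi fun _ : Fin n => ν) :=
        (hL.setLIntegral_marginal n _ hS).symm
    _ ≤ ∫⁻ y in S, c * b / 2 * ∏ i, ENNReal.ofReal (f₀ (y i)) ∂(Measure.pi fun _ : Fin n => ν) :=
        setLIntegral_mono (hp.const_mul _) fun y hy => le_of_lt hy
    _ = c * b / 2 * Measure.pi (fun _ : Fin n => f₀.toMeasure) S := by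
        rw [lintegral_const_mul _ hp, f₀.pi_toMeasure, withDensity_apply _ hS]

theorem pi_one_le_prod_ofReal_le (f : Density μ) {ψ : α → ℝ} (hψ : Measurable ψ) {n : ℕ} {t r : ℝ}
    (hr : 0 ≤ r) (hrt : r ≤ t)
    (h : ∫⁻ x, ENNReal.ofReal (ψ x) ∂f.toMeasure ≤ ENNReal.ofReal (Real.exp (-(t ^ 2 / 16)))) :
    Measure.pi (fun _ : Fin n => f.toMeasure) {y | 1 ≤ ∏ i, ENNReal.ofReal (ψ (y i))} ≤
      ENNReal.ofReal (Real.exp (-(n * r ^ 2 / 16))) := by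
  refine (pi_one_le_prod_le f.toMeasure n hψ.ennreal_ofReal).trans ((pow_le_pow_left' h n).trans ?_)
  rw [← ENNReal.ofReal_pow (Real.exp_pos _).le, ← Real.exp_nat_mul]
  refine ENNReal.ofReal_le_ofReal (Real.exp_le_exp.2 ?_)
  have h1 : r ^ 2 ≤ t ^ 2 := pow_le_pow_left₀ hr hrt 2
  have h2 := mul_le_mul_of_nonneg_left h1 (Nat.cast_nonneg (α := ℝ) n)
  linarith

/-- If `U` is, up to prior mass `a`, covered by balls whose centres are far from `f₀`, then the
posterior mass of `U` is small where the marginal likelihood is not too small. -/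
theorem pi_posteriorMeasure_gt_le [SigmaFinite μ] (d : DistanceKind) {L : Density μ → α → ℝ≥0∞}
    (hL : IsLikelihood L) (P : Measure (Density μ)) [IsProbabilityMeasure P] (f₀ : Density μ)
    {r e : ℝ} (hr : 0 ≤ r) (her : e ≤ r / 16) (T : Finset (Density μ))
    (hT : ∀ c ∈ T, r ≤ d.dist c f₀) {U : Set (Density μ)} (hU : MeasurableSet U)
    {s η : ℝ≥0∞} (hs0 : s ≠ 0) (hs : s ≠ ∞) (hη0 : η ≠ 0) (hη : η ≠ ∞) (n : ℕ) :
    Measure.pi (fun _ : Fin n => f₀.toMeasure) {y | η < posteriorMeasure P L y U} ≤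
      Measure.pi (fun _ : Fin n => f₀.toMeasure)
          {y | ∫⁻ f, ∏ i, L f (y i) ∂P < s * ∏ i, ENNReal.ofReal (f₀ (y i))} +
        T.card * ENNReal.ofReal (Real.exp (-(n * r ^ 2 / 16))) +
        (η * s)⁻¹ * (ENNReal.ofReal (Real.exp (-(n * r ^ 2 / 16))) +
          P (U \ {f | ∃ c ∈ T, d.dist f c ≤ e})) := by
  set Q := ENNReal.ofReal (Real.exp (-(n * r ^ 2 / 16))) with hQ
  set W : Set (Density μ) := {f | ∃ c ∈ T, d.dist f c ≤ e} with hWdef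
  have hW : MeasurableSet W := by
    have : W = ⋃ c ∈ T, {f | d.dist f c ≤ e} := by ext f; simp [hWdef]
    rw [this]
    exact T.measurableSet_biUnion fun c _ =>
      measurableSet_le (d.measurable_dist hL c) measurable_const
  choose ψ hψm hψpos hψ0 hψ1 using exists_test_statistic d f₀
  -- Reject when some centre's test rejects: errors under `f₀` add up over the centres, while a
  -- density in `W` needs only the test of one nearby centre.
  set φ : Set (Fin n → α) := ⋃ c ∈ T, {y | 1 ≤ ∏ i, ENNReal.ofReal (ψ c (y i))⁻¹} with hφdef
  have hφ : MeasurableSet φ := T.measurableSet_biUnion fun c _ =>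
    measurableSet_le measurable_const <| Finset.measurable_prod _ fun i _ =>
      (((hψm c).comp (measurable_pi_apply i)).inv).ennreal_ofReal
  have hφ0 : Measure.pi (fun _ : Fin n => f₀.toMeasure) φ ≤ T.card * Q := by
    refine (measure_biUnion_finset_le T _).trans ?_
    rw [← nsmul_eq_mul]
    exact Finset.sum_le_card_nsmul _ _ _ fun c hc =>
      pi_one_le_prod_ofReal_le f₀ (hψm c).inv hr (hT c hc) (hψ0 c)
  have hφ1 : ∀ f ∈ W, Measure.pi (fun _ : Fin n => f.toMeasure) φᶜ ≤ Q := by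
    rintro f ⟨c, hc, hfc⟩
    refine (measure_mono fun y hy => ?_).trans (pi_one_le_prod_ofReal_le f (hψm c) hr (hT c hc)
      (hψ1 c f (hfc.trans (her.trans (div_le_div_of_nonneg_right (hT c hc) (by norm_num))))))
    have hlt : ¬ (1 : ℝ≥0∞) ≤ ∏ i, ENNReal.ofReal (ψ c (y i))⁻¹ := fun hle =>
      hy (Set.mem_biUnion hc hle)
    have hpos : 0 < ∏ i, ψ c (y i) := Finset.prod_pos fun i _ => hψpos c _
    rw [← ENNReal.ofReal_prod_of_nonneg fun i _ => (inv_pos.2 (hψpos c _)).le,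
      ENNReal.one_le_ofReal, Finset.prod_inv_distrib, one_le_inv₀ hpos, not_le] at hlt
    simp only [Set.mem_ofPred_eq]
    rw [← ENNReal.ofReal_prod_of_nonneg fun i _ => (hψpos c _).le, ENNReal.one_le_ofReal]
    exact hlt.le
  set N : (Fin n → α) → ℝ≥0∞ := fun y => ∫⁻ f in U, ∏ i, L f (y i) ∂P with hNdef
  have hNm : Measurable N := hL.measurable_marginal n (P.restrict U)
  have hN : ∫⁻ y in φᶜ, N y ∂(Measure.pi fun _ : Fin n => μ) ≤ Q + P (U \ W) := by
    rw [hL.setLIntegral_marginal n (P.restrict U) hφ.compl, ← lintegral_inter_add_sdiff _ U hW]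
    refine add_le_add ?_ ?_
    · refine (setLIntegral_mono measurable_const fun f hf => hφ1 f hf.2).trans ?_
      rw [setLIntegral_const]
      exact mul_le_of_le_one_right' prob_le_one
    · refine (setLIntegral_mono measurable_const fun f _ => prob_le_one).trans ?_
      rw [setLIntegral_const, one_mul]
  have hp : Measurable fun y : Fin n → α => ∏ i, ENNReal.ofReal (f₀ (y i)) :=
    Finset.measurable_prod _ fun i _ =>
      (f₀.measurable_toFun.comp (measurable_pi_apply i)).ennreal_ofReal
  set A : Set (Fin n → α) := {y | η * s * ∏ i, ENNReal.ofReal (f₀ (y i)) ≤ N y} ∩ φᶜ with hAdef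
  have hA : MeasurableSet A := (measurableSet_le (hp.const_mul _) hNm).inter hφ.compl
  -- Markov's inequality: on `A` the true likelihood is dominated by a multiple of `N`, whose
  -- integral off φ is already bounded.
  have hPA : Measure.pi (fun _ : Fin n => f₀.toMeasure) A ≤ (η * s)⁻¹ * (Q + P (U \ W)) := by
    rw [← ENNReal.mul_le_iff_le_inv (mul_ne_zero hη0 hs0) (ENNReal.mul_ne_top hη hs),
      f₀.pi_toMeasure, withDensity_apply _ hA, ← lintegral_const_mul _ hp]
    refine (setLIntegral_mono hNm fun y hy => hy.1).trans ?_
    exact (lintegral_mono_set Set.inter_subset_right).trans hN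
  refine le_trans (measure_mono (t := {y | ∫⁻ f, ∏ i, L f (y i) ∂P <
      s * ∏ i, ENNReal.ofReal (f₀ (y i))} ∪ φ ∪ A) fun y hy => ?_)
    ((measure_union_le _ _).trans (add_le_add ((measure_union_le _ _).trans
      (add_le_add le_rfl hφ0)) hPA))
  by_contra hcon
  simp only [Set.mem_union, Set.mem_ofPred_eq, not_or, not_lt] at hcon
  obtain ⟨⟨h1, h2⟩, h3⟩ := hcon
  refine h3 ⟨?_, h2⟩
  simp only [Set.mem_ofPred_eq, posteriorMeasure, Measure.smul_apply, smul_eq_mul,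
    withDensity_apply _ hU] at hy ⊢
  rw [mul_assoc]
  refine (mul_le_mul_right h1 _).trans ?_
  set D := ∫⁻ f, ∏ i, L f (y i) ∂P with hD
  change η < D⁻¹ * N y at hy
  have hND : N y ≤ D := setLIntegral_le_lintegral _ _
  -- In the degenerate cases D = ∞ and D = 0 the formula in `[0, ∞]` gives `U` posterior mass 0,
  -- contradicting `hy`.
  have hDtop : D ≠ ∞ := fun h => by simp [h] at hy
  have hD0 : D ≠ 0 := fun h => by
    rw [h] at hND; simp [le_zero_iff.1 hND] at hy
  rw [mul_comm]
  calc D * η ≤ D * (D⁻¹ * N y) := mul_le_mul_right hy.le _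
    _ = N y := by rw [← mul_assoc, ENNReal.mul_inv_cancel hD0 hDtop, one_mul]

end Posterior

/-! ### Covering numbers -/

theorem exists_finset_of_metricEntropy_lt {α : Type*} [MeasurableSpace α] {μ : Measure α}
    {d : DistanceKind} {δ x : ℝ} {S : Set (Density μ)} (h : metricEntropy d δ S < (x : EReal)) :
    ∃ T : Finset (Density μ), (∀ f ∈ S, ∃ c ∈ T, d.dist f c < δ) ∧
      (T.card : ℝ≥0∞) ≤ ENNReal.ofReal (Real.exp x) := by
  have h1 : ((coveringNumber d δ S : ℕ∞) : ℝ≥0∞) < ENNReal.ofReal (Real.exp x) := by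
    rw [← ENNReal.log_lt_log_iff, ENNReal.log_ofReal_of_pos (Real.exp_pos x), Real.log_exp]
    exact h
  have h2 : coveringNumber d δ S ≠ ⊤ := fun h2 => by
    rw [h2] at h1; exact absurd h1 (by simp)
  obtain ⟨k, hk⟩ := ENat.ne_top_iff_exists.1 h2
  -- A strict bound by k + 1 extracts a cover from the infimum, necessarily with at most k centres.
  have h3 : coveringNumber d δ S < ((k + 1 : ℕ) : ℕ∞) := by
    rw [← hk]; exact_mod_cast Nat.lt_succ_self k
  simp only [coveringNumber, iInf_lt_iff] at h3
  obtain ⟨T, hT, hlt⟩ := h3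
  refine ⟨T, hT, le_trans ?_ h1.le⟩
  have : T.card ≤ k := Nat.lt_succ_iff.1 (by exact_mod_cast hlt)
  rw [← hk]
  exact_mod_cast this

/-! ### Posterior contraction for rounded data -/

theorem Rounding.dist_g_le {p₁ p₂ : ℕ} {q : Fin p₂ → ℕ∞} (R : Rounding p₁ q) (d : DistanceKind)
    (f c : Density (volume : Measure (Latent p₁ p₂))) : d.dist (R.g f) (R.g c) ≤ d.dist f c :=
  dist_le_of_map d R.measurable_h (R.toMeasure_g f) (R.toMeasure_g c)

theorem Rounding.pi_posteriorMeasure_map_g_gt_le {p₁ p₂ : ℕ} {q : Fin p₂ → ℕ∞}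
    (R : Rounding p₁ q)
    (Pstar : Measure (Density (volume : Measure (Latent p₁ p₂)))) [IsProbabilityMeasure Pstar]
    (f₀ : Density R.μ) (f₀star : Density (volume : Measure (Latent p₁ p₂)))
    (hf₀ : R.g f₀star =ᵐ[R.μ] f₀) (d : DistanceKind) {ε C M η : ℝ} {n : ℕ}
    (hM : 17 + 16 * (C + 4) ≤ M) (hη : 0 < η) (hC : 0 < C) (hn : 0 < (n : ℝ) * ε ^ 2)
    {F : Set (Density (volume : Measure (Latent p₁ p₂)))}
    (h_entropy : metricEntropy d ε F < ((C * n * ε ^ 2 : ℝ) : EReal))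
    (h_sieve : Pstar Fᶜ ≤ ENNReal.ofReal (Real.exp (-(n * ε ^ 2 * (C + 4)))))
    (h_prior : ENNReal.ofReal (Real.exp (-(C * n * ε ^ 2))) ≤ Pstar (klNeighborhood f₀star ε))
    {L : Density R.μ → Mixed p₁ q → ℝ≥0∞} (hL : IsLikelihood L) :
    Measure.pi (fun _ : Fin n => f₀.toMeasure)
        {y | ENNReal.ofReal η <
          posteriorMeasure (Pstar.map R.g) L y {f | d.dist f f₀ ≤ M * ε}ᶜ} ≤
      ENNReal.ofReal (2 * (1 / (n * ε ^ 2)) + Real.exp (-(4 * (n * ε ^ 2))) +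
        4 / η * Real.exp (-(2 * (n * ε ^ 2)))) := by
  classical
  have hprob : IsProbabilityMeasure (Pstar.map R.g) :=
    Measure.isProbabilityMeasure_map R.measurable_g.aemeasurable
  obtain ⟨T, hTF, hcard⟩ := exists_finset_of_metricEntropy_lt h_entropy
  -- The sieve cannot be empty, since its complement has mass below one; a member of it lies at
  -- distance less than ε from a centre.
  have hε : 0 < ε := by
    have hF : F.Nonempty := by
      by_contra h
      rw [Set.not_nonempty_iff_eq_empty.1 h, Set.compl_empty, measure_univ,
        ENNReal.one_le_ofReal, Real.one_le_exp_iff] at h_sieve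
      nlinarith
    obtain ⟨f, hf⟩ := hF
    obtain ⟨c, -, hc⟩ := hTF f hf
    exact (d.dist_nonneg f c).trans_lt hc
  set x := (n : ℝ) * ε ^ 2 with hx
  have hCx : C * n * ε ^ 2 = C * x := by rw [hx]; ring
  rw [hCx] at hcard h_prior
  -- A ball of radius ε containing a density farther than Mε from `f₀` has its centre farther than
  -- (M-1)ε, so only such centres are kept.
  set r := (M - 1) * ε with hr
  set T' : Finset (Density R.μ) := (T.image R.g).filter fun c => r ≤ d.dist c f₀ with hT'
  have hU : MeasurableSet {f : Density R.μ | d.dist f f₀ ≤ M * ε}ᶜ :=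
    (measurableSet_le (d.measurable_dist hL f₀) measurable_const).compl
  have hW : MeasurableSet {f : Density R.μ | ∃ c ∈ T', d.dist f c ≤ ε} := by
    have : {f : Density R.μ | ∃ c ∈ T', d.dist f c ≤ ε} = ⋃ c ∈ T', {f | d.dist f c ≤ ε} := by
      ext f; simp
    rw [this]
    exact T'.measurableSet_biUnion fun c _ =>
      measurableSet_le (d.measurable_dist hL c) measurable_const
  have hUW : Pstar.map R.g ({f : Density R.μ | d.dist f f₀ ≤ M * ε}ᶜ \
      {f | ∃ c ∈ T', d.dist f c ≤ ε}) ≤ ENNReal.ofReal (Real.exp (-(x * (C + 4)))) := by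
    rw [Measure.map_apply R.measurable_g (hU.diff hW)]
    -- Monotonicity holds for outer measure, so the sieve may be non-measurable.
    refine (measure_mono fun f hf hfF => ?_).trans h_sieve
    obtain ⟨c, hcT, hc⟩ := hTF f hfF
    have hgc := (R.dist_g_le d f c).trans hc.le
    refine hf.2 ⟨R.g c, Finset.mem_filter.2 ⟨Finset.mem_image_of_mem _ hcT, ?_⟩, hgc⟩
    have h1 : M * ε < d.dist (R.g f) f₀ := not_le.1 hf.1
    have h2 := d.dist_triangle (R.g f) (R.g c) f₀
    rw [hr]; linarith
  have hf₀' : f₀.toMeasure = f₀star.toMeasure.map R.h := by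
    rw [← R.toMeasure_g, Density.toMeasure_eq_of_ae_eq hf₀]
  have hev := pi_marginal_lt_le R.measurable_h R.measurable_g R.toMeasure_g hf₀' hL Pstar hn
    (ENNReal.ofReal_pos.2 (Real.exp_pos _)).ne' h_prior
  set s : ℝ := Real.exp (-(2 * x)) * Real.exp (-(C * x)) / 2 with hs
  have hspos : 0 < s := by positivity
  have hsE : ENNReal.ofReal (Real.exp (-(2 * x))) * ENNReal.ofReal (Real.exp (-(C * x))) / 2 =
      ENNReal.ofReal s := by
    rw [hs, ENNReal.ofReal_div_of_pos two_pos, ENNReal.ofReal_mul (Real.exp_pos _).le]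
    simp
  rw [← hx, hsE] at hev
  have hbound := pi_posteriorMeasure_gt_le d hL (Pstar.map R.g) f₀ (r := r) (e := ε)
    (mul_nonneg (by linarith) hε.le) (by rw [hr]; nlinarith) T'
    (fun c hc => (Finset.mem_filter.1 hc).2) hU (s := ENNReal.ofReal s) (η := ENNReal.ofReal η)
    (ENNReal.ofReal_pos.2 hspos).ne' ENNReal.ofReal_ne_top (ENNReal.ofReal_pos.2 hη).ne'
    ENNReal.ofReal_ne_top n
  have hq : ENNReal.ofReal (Real.exp (-(n * r ^ 2 / 16))) ≤
      ENNReal.ofReal (Real.exp (-(x * (C + 4)))) := by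
    refine ENNReal.ofReal_le_ofReal (Real.exp_le_exp.2 (neg_le_neg ?_))
    have e1 : (n : ℝ) * r ^ 2 / 16 = x * ((M - 1) ^ 2 / 16) := by rw [hr, hx]; ring
    rw [e1]
    refine mul_le_mul_of_nonneg_left ?_ hn.le
    nlinarith
  have hcard' : (T'.card : ℝ≥0∞) ≤ ENNReal.ofReal (Real.exp (C * x)) := by
    refine le_trans ?_ hcard
    exact_mod_cast (Finset.card_filter_le _ _).trans Finset.card_image_le
  refine hbound.trans ?_
  have h1 : 2 * ENNReal.ofReal (1 / x) = ENNReal.ofReal (2 * (1 / x)) := by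
    rw [ENNReal.ofReal_mul two_pos.le]; simp
  have h2 : ENNReal.ofReal (Real.exp (C * x)) * ENNReal.ofReal (Real.exp (-(x * (C + 4)))) =
      ENNReal.ofReal (Real.exp (-(4 * x))) := by
    rw [← ENNReal.ofReal_mul (Real.exp_pos _).le, ← Real.exp_add]
    congr 2; ring
  -- Here the constant C + 4 is spent: the evidence bound costs exp((C+2)x), leaving exp(-2x). The 4
  -- is 2 from the half in s times 2 equal terms.
  have h3 : (ENNReal.ofReal η * ENNReal.ofReal s)⁻¹ *
      (ENNReal.ofReal (Real.exp (-(x * (C + 4)))) + ENNReal.ofReal (Real.exp (-(x * (C + 4))))) =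
      ENNReal.ofReal (4 / η * Real.exp (-(2 * x))) := by
    rw [← ENNReal.ofReal_mul hη.le, ← ENNReal.ofReal_inv_of_pos (mul_pos hη hspos),
      ← ENNReal.ofReal_add (Real.exp_pos _).le (Real.exp_pos _).le,
      ← ENNReal.ofReal_mul (inv_pos.2 (mul_pos hη hspos)).le]
    congr 1
    have e1 : Real.exp (-(x * (C + 4))) =
        Real.exp (-(2 * x)) * (Real.exp (-(2 * x)) * Real.exp (-(C * x))) := by
      rw [← Real.exp_add, ← Real.exp_add]; congr 1; ring
    rw [hs, e1]
    field_simp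
    norm_num
  rw [ENNReal.ofReal_add (by positivity) (by positivity),
    ENNReal.ofReal_add (by positivity) (by positivity), ← h1, ← h2, ← h3]
  exact add_le_add (add_le_add hev (mul_le_mul' hcard' hq)) (mul_le_mul_right (add_le_add hq hUW) _)

theorem tendsto_ofReal_inv_add_exp {x : ℕ → ℝ} (hx : Tendsto x atTop atTop) (η : ℝ) :
    Tendsto (fun n => ENNReal.ofReal (2 * (1 / x n) + Real.exp (-(4 * x n)) +
      4 / η * Real.exp (-(2 * x n)))) atTop (𝓝 0) := by
  have hexp : ∀ k : ℝ, 0 < k → Tendsto (fun n => Real.exp (-(k * x n))) atTop (𝓝 0) :=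
    fun k hk => Real.tendsto_exp_neg_atTop_nhds_zero.comp (hx.const_mul_atTop hk)
  have hinv : Tendsto (fun n => 1 / x n) atTop (𝓝 0) := by
    simp_rw [one_div]
    exact tendsto_inv_atTop_zero.comp hx
  have h := ((hinv.const_mul 2).add (hexp 4 (by norm_num))).add
    ((hexp 2 two_pos).const_mul (4 / η))
  simpa using ENNReal.tendsto_ofReal h

end

theorem theorem2 {p₁ p₂ : ℕ} {q : Fin p₂ → ℕ∞} (R : Rounding p₁ q)
    (Pstar : Measure (Density (volume : Measure (Latent p₁ p₂)))) [IsProbabilityMeasure Pstar]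
    (f₀ : Density R.μ) (f₀star : Density (volume : Measure (Latent p₁ p₂)))
    (hf₀ : R.g f₀star =ᵐ[R.μ] f₀)
    (d : DistanceKind) (ε : ℕ → ℝ)
    (hε : Tendsto ε atTop (𝓝 0))
    (hnε : Tendsto (fun n : ℕ => (n : ℝ) * ε n ^ 2) atTop atTop)
    (C : ℝ) (hC : 0 < C) (Fstar : ℕ → Set (Density (volume : Measure (Latent p₁ p₂))))
    (h_entropy : ∀ᶠ n : ℕ in atTop,
      metricEntropy d (ε n) (Fstar n) < ((C * n * ε n ^ 2 : ℝ) : EReal))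
    (h_sieve : ∀ᶠ n : ℕ in atTop,
      Pstar (Fstar n)ᶜ ≤ ENNReal.ofReal (Real.exp (-(n * ε n ^ 2 * (C + 4)))))
    (h_prior : ∀ᶠ n : ℕ in atTop,
      ENNReal.ofReal (Real.exp (-(C * n * ε n ^ 2))) ≤ Pstar (klNeighborhood f₀star (ε n)))
    (L : Density R.μ → Mixed p₁ q → ℝ≥0∞) (hL : IsLikelihood L) :
    ∃ M₀ : ℝ, ∀ M : ℝ, M₀ ≤ M → ∀ η : ℝ, 0 < η →
      Tendsto (fun n : ℕ => Measure.pi (fun _ : Fin n => f₀.toMeasure)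
        {y | ENNReal.ofReal η <
          posteriorMeasure (Pstar.map R.g) L y {f | d.dist f f₀ ≤ M * ε n}ᶜ})
        atTop (𝓝 0) := by
  -- M ≥ 17 gives ε ≤ r/16, as the tests require; the full bound gives (M-1)²/16 ≥ C + 4, so the
  -- test errors are as small as the mass outside the sieve.
  refine ⟨17 + 16 * (C + 4), fun M hM η hη => ?_⟩
  refine tendsto_of_tendsto_of_tendsto_of_le_of_le' tendsto_const_nhds
    (tendsto_ofReal_inv_add_exp hnε η) (Eventually.of_forall fun _ => zero_le) ?_
  filter_upwards [h_entropy, h_sieve, h_prior, hnε.eventually_gt_atTop 0] with n h1 h2 h3 h4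
  exact R.pi_posteriorMeasure_map_g_gt_le Pstar f₀ f₀star hf₀ d hM hη hC h4 h1 h2 h3 hL
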